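/- An automaton is a triple $\mathscr A=(Q,\Sigma,\delta)$ with a finite set $Q$ of $n$ states, a finite alphabet $\Sigma$ and a transition function $\delta\colon Q\times\Sigma\to Q$, extended to words $w\in\Sigma^*$ (including the empty word) as usual; $\delta(T,w)=\{\delta(q,w)\mid q\in T\}$ and $\delta^{-1}(T,w)=\{q\in Q\mid\delta(q,w)\in T\}$ for $T\subseteq Q$. A set $T\subseteq Q$ is a *predecessor* of $S\subseteq Q$ if $\delta(T,w)=S$ for some $w\in\Sigma^*$ (a *$w$-predecessor*). The automaton is *completely reachable* if $Q$ is a predecessor of every non-empty $S\subseteq Q$. A non-empty set $S\subsetneq Q$ is a *witness candidate* if no predecessor $T$ of $S$ satisfies $|T|>|S|$, and any two distinct predecessors of $S$ have disjoint complements in $Q$. The problem *Completely Reachable* asks, given an automaton (with $Q=\{0,\dots,n-1\}$, $\Sigma=\{0,\dots,k-1\}$, encoded as a bit string by writing each of the numbers $n$, $k$ and the entries $\delta(q,a)$, letter by letter, in unary as $1^m0$), whether it is completely reachable. The algorithm *IsWitnessCandidate* takes an automaton and a non-empty $S\subsetneq Q$. It keeps a FIFO queue of subsets of $Q$, initially containing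 only $S$, and an array $\mathrm{Absent}$ indexed by $Q$, initially "none" everywhere. While the queue is not empty, it pops a set $T$ and does the following. 1. If $|T|>|S|$, it returns false. 2. Otherwise, if $\mathrm{Absent}[q]=T'$ is not none for some $q\notin T$ (one such $q$ is picked), it returns false if $T'\ne T$ and proceeds to the next iteration if $T'=T$. 3. Otherwise, it sets $\mathrm{Absent}[q]$ to (a pointer to) $T$ for all $q\notin T$, and for each $a\in\Sigma$ it pushes $\delta^{-1}(T,a)$ on the queue if this set is an $a$-predecessor of $T$. When the queue is empty, it returns true. It is implemented on a unit-cost random access machine (with addition, subtraction and comparison, but no multiplication), on which also the complexity classes are defined; this machine model is polynomially equivalent to Turing machines. **Theorem.** 1. The problem Completely Reachable is in co-NP: its complement, as a language of bit strings, has a polynomial-time verifier with certificates of polynomial length. 2. An automaton is not completely reachable if and only if it has a witness candidate. 3. For every $n$-state automaton and every non-empty $S\subsetneq Q$, IsWitnessCandidate halts within $O(n^2\cdot\max(1,|\Sigma|))$ steps, with an absolute constant (so within $O(n^2|\Sigma|)$ steps if $\Sigma\neq\emptyset$), and it returns true if $S$ is a witness candidate and false otherwise. -/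

import Mathlib

/-! ### Automata and reachability of subsets -/

namespace Automaton

variable {Q A : Type*}

/-- The transition function `δ : Q × Σ → Q` extended to words. -/
def act (δ : Q → A → Q) (q : Q) (w : List A) : Q := w.foldl δ q

/-- The image `δ(S, w)`. -/
def image [DecidableEq Q] (δ : Q → A → Q) (S : Finset Q) (w : List A) : Finset Q :=
  S.image (fun q => act δ q w)

/-- `T` is a predecessor of `S`: some word maps `T` onto `S`. -/
def IsPredecessor [DecidableEq Q] (δ : Q → A → Q) (T S : Finset Q) : Prop :=
  ∃ w : List A, image δ T w = S

/-- Every non-empty set of states is reachable from the set of all states. -/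
def CompletelyReachable [Fintype Q] [DecidableEq Q] (δ : Q → A → Q) : Prop :=
  ∀ S : Finset Q, S.Nonempty → IsPredecessor δ Finset.univ S

/-- A non-empty proper subset with no larger predecessor whose (distinct) predecessors have
pairwise disjoint complements. -/
def WitnessCandidate [Fintype Q] [DecidableEq Q] (δ : Q → A → Q) (S : Finset Q) : Prop :=
  S.Nonempty ∧ S ≠ Finset.univ ∧
    (∀ T, IsPredecessor δ T S → ¬ S.card < T.card) ∧
    ∀ T T', IsPredecessor δ T S → IsPredecessor δ T' S → T ≠ T' → Disjoint Tᶜ T'ᶜ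

end Automaton

/-! ### Random access machines

Structured programs for a random access machine with unit cost. The machine has registers and
arrays, all numbered by natural numbers and holding natural numbers; one program mentions only
finitely many registers and arrays. The arithmetic operations are addition, truncated subtraction
and comparison; there is no multiplication, so that a run of `t` steps only produces numbers with
`O(t)` more bits than those of the input, and the machine is polynomially equivalent to Turing
machines. -/

namespace RAM

/-- Contents of the registers and of the arrays (`arr a i` is cell `i` of array `a`). -/
structure State where
  var : ℕ → ℕ
  arr : ℕ → ℕ → ℕ

inductive Expr
  | lit (c : ℕ)
  | var (x : ℕ)
  | get (a : ℕ) (i : Expr)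
  | add (e f : Expr)
  | sub (e f : Expr)
  | lt (e f : Expr)
  | eq (e f : Expr)
  | and (e f : Expr)

/-- Value of an expression; truth values are `0` (false) and non-zero (true). -/
def Expr.eval (s : State) : Expr → ℕ
  | lit c => c
  | var x => s.var x
  | get a i => s.arr a (i.eval s)
  | add e f => e.eval s + f.eval s
  | sub e f => e.eval s - f.eval s
  | lt e f => if e.eval s < f.eval s then 1 else 0
  | eq e f => if e.eval s = f.eval s then 1 else 0
  | and e f => if e.eval s ≠ 0 ∧ f.eval s ≠ 0 then 1 else 0

/-- Evaluating an expression takes one step for each of its nodes. -/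
def Expr.cost : Expr → ℕ
  | lit _ => 1
  | var _ => 1
  | get _ i => i.cost + 1
  | add e f => e.cost + f.cost + 1
  | sub e f => e.cost + f.cost + 1
  | lt e f => e.cost + f.cost + 1
  | eq e f => e.cost + f.cost + 1
  | and e f => e.cost + f.cost + 1

inductive Cmd
  | skip
  | set (x : ℕ) (e : Expr)
  | put (a : ℕ) (i e : Expr)
  | seq (c d : Cmd)
  | ite (b : Expr) (c d : Cmd)
  | loop (b : Expr) (c : Cmd)

def State.setVar (s : State) (x v : ℕ) : State :=
  { s with var := Function.update s.var x v }

def State.setArr (s : State) (a i v : ℕ) : State :=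
  { s with arr := Function.update s.arr a (Function.update (s.arr a) i v) }

/-- `Exec c s t s'`: started in state `s`, the program `c` halts after `t` steps in state `s'`. -/
inductive Exec : Cmd → State → ℕ → State → Prop
  | skip (s : State) : Exec .skip s 1 s
  | set (s : State) (x : ℕ) (e : Expr) :
      Exec (.set x e) s (e.cost + 1) (s.setVar x (e.eval s))
  | put (s : State) (a : ℕ) (i e : Expr) :
      Exec (.put a i e) s (i.cost + e.cost + 1) (s.setArr a (i.eval s) (e.eval s))
  | seq {c d : Cmd} {s s' s'' : State} {t t' : ℕ} :
      Exec c s t s' → Exec d s' t' s'' → Exec (.seq c d) s (t + t') s''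
  | ite_true {b : Expr} {c d : Cmd} {s s' : State} {t : ℕ} :
      b.eval s ≠ 0 → Exec c s t s' → Exec (.ite b c d) s (b.cost + 1 + t) s'
  | ite_false {b : Expr} {c d : Cmd} {s s' : State} {t : ℕ} :
      b.eval s = 0 → Exec d s t s' → Exec (.ite b c d) s (b.cost + 1 + t) s'
  | loop_true {b : Expr} {c : Cmd} {s s' s'' : State} {t t' : ℕ} :
      b.eval s ≠ 0 → Exec c s t s' → Exec (.loop b c) s' t' s'' →
        Exec (.loop b c) s (b.cost + 1 + t + t') s''
  | loop_false {b : Expr} {c : Cmd} {s : State} :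
      b.eval s = 0 → Exec (.loop b c) s (b.cost + 1) s

/-- Sequential composition of a list of programs. -/
def block (l : List Cmd) : Cmd := l.foldr Cmd.seq Cmd.skip

/-- `for x = 0, …, m - 1` (the upper end is an expression that is evaluated in each round). -/
def forLoop (x : ℕ) (m : Expr) (body : List Cmd) : Cmd :=
  block [.set x (.lit 0), .loop (.lt (.var x) m)
    (block (body ++ [.set x (.add (.var x) (.lit 1))]))]

end RAM

/-! ### The classes NP and co-NP -/

namespace RAM

/-- The initial state for the pair of an input `x` and a certificate `y`: array `0` holds the bits
of `x`, array `1` the bits of `y`, registers `0` and `1` their lengths, and all else is `0`. -/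
def initState (x y : List Bool) : State where
  var i := if i = 0 then x.length else if i = 1 then y.length else 0
  arr a i :=
    if a = 0 then (x.getD i false).toNat else if a = 1 then (y.getD i false).toNat else 0

/-- `L` is in NP: some program halts in polynomial time on each input `x` and each certificate of
polynomial length, and `x ∈ L` if and only if some such certificate makes it answer `1`
(in register `0`). -/
def InNP (L : Set (List Bool)) : Prop :=
  ∃ (M : Cmd) (p : Polynomial ℕ), ∀ x : List Bool,
    (∀ y : List Bool, y.length ≤ p.eval x.length →
      ∃ t s, Exec M (initState x y) t s ∧ t ≤ p.eval x.length) ∧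
    (x ∈ L ↔ ∃ y : List Bool, y.length ≤ p.eval x.length ∧
      ∃ t s, Exec M (initState x y) t s ∧ s.var 0 = 1)

/-- `L` is in co-NP: its complement is in NP. -/
def InCoNP (L : Set (List Bool)) : Prop := InNP Lᶜ

end RAM

/-! ### The decision problem -/

namespace Automaton

/-- The numbers `n`, `k`, and then for each letter `a` the row `δ(0,a), …, δ(n-1,a)`. -/
def toWords {n k : ℕ} (δ : Fin n → Fin k → Fin n) : List ℕ :=
  n :: k :: (List.finRange k).flatMap fun a => (List.finRange n).map fun q => (δ q a : ℕ)

/-- An automaton as a bit string: each number `m` of `toWords` is written as `1ᵐ0`. For `k ≥ 1` the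
length of this string is polynomial in the number `n * k` of entries of the transition table, so
that binary numbers would give a polynomially equivalent encoding. -/
def encode {n k : ℕ} (δ : Fin n → Fin k → Fin n) : List Bool :=
  (toWords δ).flatMap fun m => List.replicate m true ++ [false]

/-- The decision problem Completely Reachable: the encodings of completely reachable automata. -/
def completelyReachableProblem : Set (List Bool) :=
  {x | ∃ (n k : ℕ) (δ : Fin n → Fin k → Fin n), x = encode δ ∧ CompletelyReachable δ}

end Automaton

/-! ### The algorithm IsWitnessCandidate

Input: registers `nV` (number `n` of states) and `kV` (number `k` of letters), the array `deltaA`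
(transition table, `δ(q,a)` in cell `a * n + q`) and the array `inputA` (characteristic vector of
`S`). Output: register `ansV`, `1` for true and `0` for false. -/

namespace IsWitnessCandidate

open RAM RAM.Expr RAM.Cmd

abbrev ansV : ℕ := 0
abbrev nV : ℕ := 1
abbrev kV : ℕ := 2
/-- Address in `queueA` of the front of the queue. -/
abbrev headV : ℕ := 3
/-- Address in `queueA` of the first cell behind the queue. -/
abbrev tailV : ℕ := 4
/-- Address in `queueA` of the set `T` being processed. -/
abbrev curV : ℕ := 5
/-- The size of `S`. -/
abbrev sizeSV : ℕ := 6
/-- The size of `T`. -/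
abbrev sizeTV : ℕ := 7
/-- `0` for none, or one plus the address of an earlier set `T'`. -/
abbrev oldV : ℕ := 8
/-- A Boolean flag. -/
abbrev flagV : ℕ := 9
abbrev qV : ℕ := 10
abbrev aV : ℕ := 11
/-- `a * n`, where `a` is the current letter. -/
abbrev baseV : ℕ := 12

abbrev deltaA : ℕ := 0
abbrev inputA : ℕ := 1
/-- The FIFO queue: characteristic vectors of `n` cells each, one behind the other. -/
abbrev queueA : ℕ := 2
/-- `Absent[q]`: `0` for none, or one plus the address of a processed set that lacks `q`. -/
abbrev absentA : ℕ := 3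
/-- Marks the states that occur as `δ(q,a)` for the current letter `a`. -/
abbrev hitA : ℕ := 4

/-- Push `S` on the empty queue, and set `Absent` to none everywhere. -/
def pushInput : Cmd := block [
  set ansV (lit 1), set headV (lit 0), set tailV (var nV), set sizeSV (lit 0),
  forLoop qV (var nV) [
    put queueA (var qV) (get inputA (var qV)),
    set sizeSV (add (var sizeSV) (get inputA (var qV))),
    put absentA (var qV) (lit 0)]]

/-- Pop `T`; compute its size, and look for a state outside `T` at which `Absent` is not none. -/
def popNext : Cmd := block [
  set curV (var headV), set headV (add (var headV) (var nV)),
  set sizeTV (lit 0), set oldV (lit 0),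
  forLoop qV (var nV) [
    ite (get queueA (add (var curV) (var qV)))
      (set sizeTV (add (var sizeTV) (lit 1)))
      (ite (get absentA (var qV)) (set oldV (get absentA (var qV))) skip)]]

/-- Set the flag if and only if `T = T'`. -/
def compareWithOld : Cmd := block [
  set flagV (lit 1),
  forLoop qV (var nV) [
    ite (eq (get queueA (add (var curV) (var qV)))
        (get queueA (add (sub (var oldV) (lit 1)) (var qV))))
      skip (set flagV (lit 0))]]

/-- `Absent[q] := T` for all `q` outside `T`. -/
def markAbsent : Cmd :=
  forLoop qV (var nV) [
    ite (get queueA (add (var curV) (var qV))) skip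
      (put absentA (var qV) (add (var curV) (lit 1)))]

/-- For each letter `a`, write `δ⁻¹(T,a)` behind the queue; keep it there if every state of `T` is
of the form `δ(q,a)`, that is, if it is an `a`-predecessor of `T`. -/
def pushPredecessors : Cmd := block [
  set baseV (lit 0),
  forLoop aV (var kV) [
    forLoop qV (var nV) [put hitA (var qV) (lit 0)],
    forLoop qV (var nV) [
      put queueA (add (var tailV) (var qV))
        (get queueA (add (var curV) (get deltaA (add (var baseV) (var qV))))),
      put hitA (get deltaA (add (var baseV) (var qV))) (lit 1)],
    set flagV (lit 1),
    forLoop qV (var nV) [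
      ite (and (get queueA (add (var curV) (var qV))) (eq (get hitA (var qV)) (lit 0)))
        (set flagV (lit 0)) skip],
    ite (var flagV) (set tailV (add (var tailV) (var nV))) skip,
    set baseV (add (var baseV) (var nV))]]

/-- The whole algorithm: a breadth-first search through the predecessors of `S`. Returning false
means to set the answer to `0`, which ends the main loop. -/
def program : Cmd := block [
  pushInput,
  loop (and (lt (var headV) (var tailV)) (var ansV)) (block [
    popNext,
    ite (lt (var sizeSV) (var sizeTV))
      (set ansV (lit 0))
      (ite (var oldV)
        (block [compareWithOld, ite (var flagV) skip (set ansV (lit 0))])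
        (block [markAbsent, pushPredecessors]))])]

/-- The state `s` contains the input `δ`, `S`; nothing is assumed about its other contents. -/
def HasInput {n k : ℕ} (δ : Fin n → Fin k → Fin n) (S : Finset (Fin n)) (s : State) : Prop :=
  s.var nV = n ∧ s.var kV = k ∧
    (∀ (q : Fin n) (a : Fin k), s.arr deltaA (a * n + q) = δ q a) ∧
    ∀ q : Fin n, s.arr inputA q = if q ∈ S then 1 else 0

end IsWitnessCandidate

/-!
The equivalence of non-complete-reachability with the existence of a witness candidate comes from a
maximality argument. A witness candidate has no larger predecessor, so `Q` does not reach it.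
Conversely, let `S` be an unreachable non-empty set of maximum size. Predecessors of `S` are
unreachable too, so all of them have the size of `S`. If two distinct ones, `T` and `T'`, had
intersecting complements, then `T ∪ T'` would be a proper subset of `Q` larger than `S`, hence the
image of `Q` under some word `w`. As the `w`-preimages of `T` and `T'` cannot be larger than `T`
and `T'`, every state of `T ∪ T'` has just one `w`-preimage; so `w` is injective on `Q`,
and `T ∪ T' = Q`, a contradiction (`union_eq_univ_of_reachable`, `exists_witnessCandidate`).

IsWitnessCandidate explores the predecessors of `S` breadth first. As long as no larger set shows
up, the only possible `a`-predecessor of a predecessor `T` is the full preimage `δ⁻¹(T, a)`, so a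
search that never fails finds all predecessors (`Search.exists_eq`). The array `Absent` detects a
pair of distinct sets with intersecting complements. The processed sets that are not repetitions
have pairwise disjoint non-empty complements, so there are at most `n` of them, they push at most
`n * k` sets, and each set on the queue costs `O(n)` steps. In the proof this is a potential: every
queued set pays for being popped, and every state at which `Absent` is none pays for processing one
new set (`MainInv`, `run_mainBody`, `run_program`).

For membership in co-NP, the verifier decodes the bit string, accepts if it does not encode an
automaton, and otherwise runs IsWitnessCandidate on the set whose characteristic vector is the
certificate (`run_verifier`).

Programs are reasoned about through weakest preconditions (`Run`): straight-line code is evaluated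
by rewriting, loops have invariants, and registers and arrays that a program does not assign to are
known to keep their values (`Agree`).
-/

/-! ### Weakest preconditions for programs -/

namespace RAM

/-- The program `c`, started in `s`, halts, and its running time and final state satisfy `P`. -/
def Run (c : Cmd) (s : State) (P : ℕ → State → Prop) : Prop :=
  ∃ t s', Exec c s t s' ∧ P t s'

theorem Run.mono {c : Cmd} {s : State} {P R : ℕ → State → Prop} (h : Run c s P)
    (hPR : ∀ t s', P t s' → R t s') : Run c s R := by
  obtain ⟨t, s', he, hp⟩ := h
  exact ⟨t, s', he, hPR _ _ hp⟩

@[simp] theorem run_skip {s : State} {P : ℕ → State → Prop} : Run .skip s P ↔ P 1 s := by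
  constructor
  · rintro ⟨t, s', he, hp⟩
    cases he
    exact hp
  · exact fun h => ⟨_, _, .skip s, h⟩

@[simp] theorem run_set {s : State} {x : ℕ} {e : Expr} {P : ℕ → State → Prop} :
    Run (.set x e) s P ↔ P (e.cost + 1) (s.setVar x (e.eval s)) := by
  constructor
  · rintro ⟨t, s', he, hp⟩
    cases he
    exact hp
  · exact fun h => ⟨_, _, .set s x e, h⟩

@[simp] theorem run_put {s : State} {a : ℕ} {i e : Expr} {P : ℕ → State → Prop} :
    Run (.put a i e) s P ↔ P (i.cost + e.cost + 1) (s.setArr a (i.eval s) (e.eval s)) := by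
  constructor
  · rintro ⟨t, s', he, hp⟩
    cases he
    exact hp
  · exact fun h => ⟨_, _, .put s a i e, h⟩

@[simp] theorem run_seq {s : State} {c d : Cmd} {P : ℕ → State → Prop} :
    Run (.seq c d) s P ↔ Run c s fun t s' => Run d s' fun t' => P (t + t') := by
  constructor
  · rintro ⟨t, s', he, hp⟩
    cases he with
    | seq h1 h2 => exact ⟨_, _, h1, _, _, h2, hp⟩
  · rintro ⟨t, s', h1, t', s'', h2, hp⟩
    exact ⟨_, _, .seq h1 h2, hp⟩

@[simp] theorem run_ite {s : State} {b : Expr} {c d : Cmd} {P : ℕ → State → Prop} :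
    Run (.ite b c d) s P ↔
      (b.eval s ≠ 0 → Run c s fun t => P (b.cost + 1 + t)) ∧
      (b.eval s = 0 → Run d s fun t => P (b.cost + 1 + t)) := by
  constructor
  · rintro ⟨t, s', he, hp⟩
    cases he with
    | ite_true hb h => exact ⟨fun _ => ⟨_, _, h, hp⟩, fun h0 => absurd h0 hb⟩
    | ite_false hb h => exact ⟨fun h0 => absurd hb h0, fun _ => ⟨_, _, h, hp⟩⟩
  · rintro ⟨h1, h2⟩
    by_cases hb : b.eval s = 0
    · obtain ⟨t, s', he, hp⟩ := h2 hb
      exact ⟨_, _, .ite_false hb he, hp⟩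
    · obtain ⟨t, s', he, hp⟩ := h1 hb
      exact ⟨_, _, .ite_true hb he, hp⟩

@[simp] theorem block_nil : block [] = .skip := rfl

@[simp] theorem block_cons (c : Cmd) (l : List Cmd) : block (c :: l) = .seq c (block l) := rfl

/-- The bound `u ≤ t + t'` absorbs the step of the `skip` at the end of `block l`, which is missing
in `block (l ++ l')`. -/
theorem run_block_append {l l' : List Cmd} {s : State} {P : ℕ → State → Prop}
    (h : Run (block l) s fun t s' => Run (block l') s' fun t' s'' => ∀ u ≤ t + t', P u s'') :
    Run (block (l ++ l')) s P := by
  induction l generalizing s P with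
  | nil =>
    rw [block_nil, run_skip] at h
    exact h.mono fun t s' h => h _ (by omega)
  | cons c l ih =>
    rw [block_cons, run_seq] at h
    rw [List.cons_append, block_cons, run_seq]
    refine h.mono fun t s' h => ih (h.mono fun t' s'' h => h.mono fun t'' s''' h u hu => ?_)
    exact h _ (by omega)

/-- The loop rule. The invariant `J` carries a potential that pays for the running time; as each
round costs at least one step, this also gives termination. -/
theorem run_loop {b : Expr} {c : Cmd} {P : ℕ → State → Prop} (J : State → ℕ → Prop)
    (step : ∀ s φ, J s φ → b.eval s ≠ 0 →
      Run c s fun t s' => ∃ φ', J s' φ' ∧ t + (b.cost + 1) + φ' ≤ φ)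
    (φ : ℕ) (s : State) (hJ : J s φ)
    (post : ∀ t s' φ', J s' φ' → b.eval s' = 0 → t + φ' ≤ φ + (b.cost + 1) → P t s') :
    Run (.loop b c) s P := by
  induction φ using Nat.strong_induction_on generalizing s P with
  | _ φ ih =>
    by_cases hb : b.eval s = 0
    · exact ⟨_, _, .loop_false hb, post _ _ _ hJ hb (by omega)⟩
    · obtain ⟨t, s', he, φ', hJ', hle⟩ := step s φ hJ hb
      obtain ⟨t', s'', he', hp⟩ := ih φ' (by omega) s' hJ'
        (P := fun t' => P (b.cost + 1 + t + t'))
        (fun t' s'' φ'' hJ'' hb'' hle' => post _ _ _ hJ'' hb'' (by omega))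
      exact ⟨_, _, .loop_true hb he he', hp⟩

theorem Exec.deterministic {c : Cmd} {s s₁ s₂ : State} {t₁ t₂ : ℕ} (h₁ : Exec c s t₁ s₁)
    (h₂ : Exec c s t₂ s₂) : t₁ = t₂ ∧ s₁ = s₂ := by
  induction h₁ generalizing t₂ s₂ with
  | skip s => cases h₂; exact ⟨rfl, rfl⟩
  | set s x e => cases h₂; exact ⟨rfl, rfl⟩
  | put s a i e => cases h₂; exact ⟨rfl, rfl⟩
  | seq _ _ ih1 ih2 =>
    cases h₂ with
    | seq h1 h2 =>
      obtain ⟨rfl, rfl⟩ := ih1 h1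
      obtain ⟨rfl, rfl⟩ := ih2 h2
      exact ⟨rfl, rfl⟩
  | ite_true hb _ ih =>
    cases h₂ with
    | ite_true _ h => obtain ⟨rfl, rfl⟩ := ih h; exact ⟨rfl, rfl⟩
    | ite_false hb' h => exact absurd hb' hb
  | ite_false hb _ ih =>
    cases h₂ with
    | ite_true hb' h => exact absurd hb hb'
    | ite_false _ h => obtain ⟨rfl, rfl⟩ := ih h; exact ⟨rfl, rfl⟩
  | loop_true hb _ _ ih1 ih2 =>
    cases h₂ with
    | loop_true _ h1 h2 =>
      obtain ⟨rfl, rfl⟩ := ih1 h1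
      obtain ⟨rfl, rfl⟩ := ih2 h2
      exact ⟨rfl, rfl⟩
    | loop_false hb' => exact absurd hb' hb
  | loop_false hb =>
    cases h₂ with
    | loop_true hb' h1 h2 => exact absurd hb hb'
    | loop_false _ => exact ⟨rfl, rfl⟩

/-! ### Frame conditions and counting loops -/

/-- Whether the program contains an assignment to register `v`. -/
def Cmd.writesVar (v : ℕ) : Cmd → Bool
  | skip => false
  | set x _ => x == v
  | put _ _ _ => false
  | seq c d => c.writesVar v || d.writesVar v
  | ite _ c d => c.writesVar v || d.writesVar v
  | loop _ c => c.writesVar v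

/-- Whether the program contains an assignment to a cell of array `a`. -/
def Cmd.writesArr (a : ℕ) : Cmd → Bool
  | skip => false
  | set _ _ => false
  | put b _ _ => b == a
  | seq c d => c.writesArr a || d.writesArr a
  | ite _ c d => c.writesArr a || d.writesArr a
  | loop _ c => c.writesArr a

/-- The states `s` and `s'` agree on everything that the program `c` does not assign to. -/
structure Agree (c : Cmd) (s s' : State) : Prop where
  var : ∀ v, c.writesVar v = false → s'.var v = s.var v
  arr : ∀ a, c.writesArr a = false → s'.arr a = s.arr a

theorem Agree.trans {c : Cmd} {s s' s'' : State} (h : Agree c s s') (h' : Agree c s' s'') :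
    Agree c s s'' :=
  ⟨fun v hv => (h'.var v hv).trans (h.var v hv), fun a ha => (h'.arr a ha).trans (h.arr a ha)⟩

theorem Agree.weaken {c d : Cmd} {s s' : State} (h : Agree c s s')
    (hv : ∀ v, d.writesVar v = false → c.writesVar v = false)
    (ha : ∀ a, d.writesArr a = false → c.writesArr a = false) : Agree d s s' :=
  ⟨fun v h' => h.var v (hv v h'), fun a h' => h.arr a (ha a h')⟩

theorem Exec.agree {c : Cmd} {s s' : State} {t : ℕ} (h : Exec c s t s') : Agree c s s' := by
  induction h with
  | skip s => exact ⟨fun _ _ => rfl, fun _ _ => rfl⟩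
  | set s x e =>
    refine ⟨fun v hv => ?_, fun _ _ => rfl⟩
    exact Function.update_of_ne (Ne.symm (by simpa [Cmd.writesVar] using hv)) _ _
  | put s a i e =>
    refine ⟨fun _ _ => rfl, fun b hb => ?_⟩
    exact Function.update_of_ne (Ne.symm (by simpa [Cmd.writesArr] using hb)) _ _
  | seq _ _ ih1 ih2 =>
    refine (ih1.weaken ?_ ?_).trans (ih2.weaken ?_ ?_) <;>
      simp +contextual [Cmd.writesVar, Cmd.writesArr]
  | ite_true _ _ ih =>
    refine ih.weaken ?_ ?_ <;> simp +contextual [Cmd.writesVar, Cmd.writesArr]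
  | ite_false _ _ ih =>
    refine ih.weaken ?_ ?_ <;> simp +contextual [Cmd.writesVar, Cmd.writesArr]
  | loop_true _ _ _ ih1 ih2 =>
    refine (ih1.weaken ?_ ?_).trans ih2 <;> simp [Cmd.writesVar, Cmd.writesArr]
  | loop_false _ => exact ⟨fun _ _ => rfl, fun _ _ => rfl⟩

theorem Run.and_agree {c : Cmd} {s : State} {P : ℕ → State → Prop} (h : Run c s P) :
    Run c s fun t s' => P t s' ∧ Agree c s s' := by
  obtain ⟨t, s', he, hp⟩ := h
  exact ⟨t, s', he, hp, he.agree⟩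

@[simp] theorem setVar_arr (s : State) (x v : ℕ) : (s.setVar x v).arr = s.arr := rfl

@[simp] theorem setArr_var (s : State) (a i v : ℕ) : (s.setArr a i v).var = s.var := rfl

theorem setVar_var (s : State) (x v y : ℕ) :
    (s.setVar x v).var y = if y = x then v else s.var y := by
  simp [State.setVar, Function.update_apply]

theorem setArr_arr (s : State) (a i v b : ℕ) :
    (s.setArr a i v).arr b = if b = a then Function.update (s.arr a) i v else s.arr b := by
  simp [State.setArr, Function.update_apply]

theorem writesVar_block_append (l l' : List Cmd) (v : ℕ) :
    (block (l ++ l')).writesVar v = ((block l).writesVar v || (block l').writesVar v) := by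
  induction l with
  | nil => simp [Cmd.writesVar]
  | cons c l ih => simp [Cmd.writesVar, ih, Bool.or_assoc]

theorem writesArr_block_append (l l' : List Cmd) (v : ℕ) :
    (block (l ++ l')).writesArr v = ((block l).writesArr v || (block l').writesArr v) := by
  induction l with
  | nil => simp [Cmd.writesArr]
  | cons c l ih => simp [Cmd.writesArr, ih, Bool.or_assoc]

/-- The rule for counting loops whose upper end is a register. In the invariant `I i`, `i` is the
number of completed rounds and `B` bounds the time of one run of the body; the values of everything
that the loop does not assign to are kept automatically. A round takes up to `B + 9` steps: `4` for
the test and `5` for the increment with the final `skip`. -/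
theorem run_forLoop {x y : ℕ} {body : List Cmd} {s : State} {P : ℕ → State → Prop}
    (I : ℕ → State → Prop) (B N : ℕ) (hN : s.var y = N)
    (hx : (block body).writesVar x = false)
    (hy : (forLoop x (.var y) body).writesVar y = false)
    (init : I 0 (s.setVar x 0))
    (step : ∀ i s', i < N → s'.var x = i → Agree (forLoop x (.var y) body) s s' → I i s' →
      Run (block body) s' fun t s'' => t ≤ B ∧ I (i + 1) (s''.setVar x (i + 1)))
    (post : ∀ t s', t ≤ N * (B + 9) + 7 → Agree (forLoop x (.var y) body) s s' → I N s' →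
      P t s') :
    Run (forLoop x (.var y) body) s P := by
  have agree_set : ∀ s v, Agree (forLoop x (.var y) body) s (s.setVar x v) := by
    intro s v
    refine ⟨fun w hw => ?_, fun _ _ => rfl⟩
    rw [setVar_var, if_neg]
    rintro rfl
    simp [forLoop, Cmd.writesVar] at hw
  have agree_body : ∀ s s', Agree (block body) s s' →
      Agree (forLoop x (.var y) body) s s' := by
    intro s s' h
    refine h.weaken ?_ ?_ <;>
      simp +contextual [forLoop, Cmd.writesVar, Cmd.writesArr, writesVar_block_append,
        writesArr_block_append]
  suffices h : Run (forLoop x (.var y) body) s fun t s' =>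
      t ≤ N * (B + 9) + 7 ∧ I N s' ∧ Agree (forLoop x (.var y) body) s s' from
    h.mono fun t s' h => post t s' h.1 h.2.2 h.2.1
  have hyx : y ≠ x := by
    rintro rfl
    simp [forLoop, Cmd.writesVar] at hy
  unfold forLoop
  rw [block_cons, run_seq, run_set, block_cons, run_seq]
  refine run_loop (fun s' φ => ∃ i ≤ N, s'.var x = i ∧ I i s' ∧
    Agree (forLoop x (.var y) body) s s' ∧ φ = (N - i) * (B + 9)) ?_ (N * (B + 9)) _ ?_ ?_
  · rintro s' _ ⟨i, -, hi, hI, hag, rfl⟩ hb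
    have hlt : i < N := by
      have : s'.var y = N := (hag.var y hy).trans hN
      by_contra hcon
      simp [Expr.eval, hi, this, hcon] at hb
    apply run_block_append
    refine (step i s' hlt hi hag hI).and_agree.mono ?_
    rintro t s'' ⟨⟨ht, hI'⟩, hag'⟩
    have hi' : s''.var x = i := (hag'.var x hx).trans hi
    simp only [block_cons, block_nil, run_seq, run_set, run_skip, Expr.eval, Expr.cost, hi']
    intro u hu
    refine ⟨_, ⟨i + 1, hlt, ?_, hI', (hag.trans (agree_body _ _ hag')).trans (agree_set _ _),
      rfl⟩, ?_⟩
    · simp [setVar_var]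
    · obtain ⟨d, rfl⟩ := Nat.exists_eq_add_of_lt hlt
      have e1 : i + d + 1 - i = d + 1 := by omega
      have e2 : i + d + 1 - (i + 1) = d := by omega
      rw [e1, e2, Nat.succ_mul]
      omega
  · refine ⟨0, Nat.zero_le _, ?_, init, agree_set _ _, by simp⟩
    simp [setVar_var, Expr.eval]
  · rintro t s' _ ⟨i, hiN, hi, hI, hag, rfl⟩ hb hle
    have hiN' : i = N := by
      have : s'.var y = N := (hag.var y hy).trans hN
      by_contra hcon
      have : i < N := by omega
      simp_all [Expr.eval]
    subst hiN'
    simp only [block_nil, run_skip, Expr.cost] at hle ⊢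
    exact ⟨by omega, hI, hag⟩

end RAM

/-! ### Witness candidates -/

namespace Automaton

section

variable {Q A : Type*} {δ : Q → A → Q}

theorem act_append (q : Q) (v w : List A) : act δ q (v ++ w) = act δ (act δ q v) w :=
  List.foldl_append

variable [DecidableEq Q]

theorem image_append (S : Finset Q) (v w : List A) :
    image δ S (v ++ w) = image δ (image δ S v) w := by
  simp only [image, Finset.image_image]
  exact Finset.image_congr fun q _ => act_append q v w

theorem IsPredecessor.refl (S : Finset Q) : IsPredecessor δ S S :=
  ⟨[], by simp [image, act]⟩

theorem IsPredecessor.trans {R S T : Finset Q} (h : IsPredecessor δ R S)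
    (h' : IsPredecessor δ S T) : IsPredecessor δ R T := by
  obtain ⟨v, rfl⟩ := h
  obtain ⟨w, rfl⟩ := h'
  exact ⟨v ++ w, image_append _ _ _⟩

theorem IsPredecessor.card_le {S T : Finset Q} (h : IsPredecessor δ T S) : S.card ≤ T.card := by
  obtain ⟨w, rfl⟩ := h
  exact Finset.card_image_le

variable [Fintype Q]

/-- If `T ∪ T'` is the image of `Q` under `w`, and neither `T` nor `T'` has a larger predecessor,
then every state of `T ∪ T'` has just one `w`-preimage; so `w` is injective on `Q`. -/
theorem union_eq_univ_of_reachable {T T' : Finset Q}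
    (hT : ∀ R, IsPredecessor δ R T → R.card ≤ T.card)
    (hT' : ∀ R, IsPredecessor δ R T' → R.card ≤ T'.card)
    (h : IsPredecessor δ Finset.univ (T ∪ T')) : T ∪ T' = Finset.univ := by
  obtain ⟨w, hw⟩ := h
  have key : ∀ U ⊆ T ∪ T', (∀ R, IsPredecessor δ R U → R.card ≤ U.card) →
      ∀ p q, act δ p w ∈ U → act δ p w = act δ q w → p = q := by
    intro U hU hmax p q hp hpq
    have himg : (Finset.univ.filter fun q => act δ q w ∈ U).image (fun q => act δ q w) = U := by
      ext r
      simp only [Finset.mem_image, Finset.mem_filter, Finset.mem_univ, true_and]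
      constructor
      · rintro ⟨q, hq, rfl⟩
        exact hq
      · intro hr
        have := hU hr
        rw [← hw] at this
        obtain ⟨q, -, rfl⟩ := Finset.mem_image.1 this
        exact ⟨q, hr, rfl⟩
    -- The preimage of `U` is a predecessor of `U`, hence not larger than its own image `U`.
    have hinj := Finset.card_image_iff.1 (le_antisymm Finset.card_image_le
      (himg.symm ▸ hmax _ ⟨w, himg⟩ : _ ≤ ((Finset.univ.filter fun q => act δ q w ∈ U).image
        fun q => act δ q w).card))
    exact hinj (by simpa using hp) (by simpa [hpq] using hpq ▸ hp) hpq
  have hinj : Function.Injective fun q => act δ q w := by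
    intro p q hpq
    have hp : act δ p w ∈ T ∪ T' := hw ▸ Finset.mem_image_of_mem _ (Finset.mem_univ p)
    rcases Finset.mem_union.1 hp with hp | hp
    · exact key T Finset.subset_union_left hT p q hp hpq
    · exact key T' Finset.subset_union_right hT' p q hp hpq
  apply Finset.eq_univ_of_card
  rw [← hw]
  exact Finset.card_image_of_injective _ hinj

theorem WitnessCandidate.not_completelyReachable {S : Finset Q} (h : WitnessCandidate δ S) :
    ¬ CompletelyReachable δ := fun hr =>
  h.2.2.1 _ (hr S h.1) (Finset.card_lt_univ_of_notMem
    (Classical.choose_spec (not_forall.1 (mt Finset.eq_univ_iff_forall.2 h.2.1))))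

/-- An unreachable non-empty set of maximum size is a witness candidate. -/
theorem exists_witnessCandidate (h : ¬ CompletelyReachable δ) : ∃ S, WitnessCandidate δ S := by
  classical
  simp only [CompletelyReachable, not_forall, exists_prop] at h
  obtain ⟨S₀, hS₀⟩ := h
  obtain ⟨S, hS, hmax⟩ := Finset.exists_max_image
    (Finset.univ.filter fun S : Finset Q => S.Nonempty ∧ ¬ IsPredecessor δ Finset.univ S)
    Finset.card ⟨S₀, by simpa using hS₀⟩
  simp only [Finset.mem_filter, Finset.mem_univ, true_and] at hS hmax
  have hle : ∀ T, IsPredecessor δ T S → T.card ≤ S.card := by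
    intro T hT
    refine hmax T ⟨?_, fun hr => hS.2 (hr.trans hT)⟩
    exact Finset.card_pos.1 (hS.1.card_pos.trans_le hT.card_le)
  refine ⟨S, hS.1, ?_, fun T hT => (hle T hT).not_gt, fun T T' hT hT' hne => ?_⟩
  · rintro rfl
    exact hS.2 (.refl _)
  have hcard : ∀ T, IsPredecessor δ T S → T.card = S.card := fun T hT =>
    (hle T hT).antisymm hT.card_le
  have hlt : T.card < (T ∪ T').card := by
    refine Finset.card_lt_card (Finset.ssubset_iff_subset_ne.2 ⟨Finset.subset_union_left, ?_⟩)
    intro heq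
    refine hne (Finset.eq_of_subset_of_card_le ?_ ?_).symm
    · exact heq.symm ▸ Finset.subset_union_right
    · rw [hcard T hT, hcard T' hT']
  have hreach : IsPredecessor δ Finset.univ (T ∪ T') := by
    by_contra hcon
    refine absurd (hmax _ ⟨Finset.card_pos.1 (by omega), hcon⟩) ?_
    rw [← hcard T hT]
    exact hlt.not_ge
  have huniv := union_eq_univ_of_reachable
    (fun R hR => (hle R (hR.trans hT)).trans_eq (hcard T hT).symm)
    (fun R hR => (hle R (hR.trans hT')).trans_eq (hcard T' hT').symm) hreach
  rw [Finset.disjoint_iff_inter_eq_empty, ← Finset.compl_union, huniv, Finset.compl_univ]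

theorem not_completelyReachable_iff :
    ¬ CompletelyReachable δ ↔ ∃ S, WitnessCandidate δ S :=
  ⟨exists_witnessCandidate, fun ⟨_, h⟩ => h.not_completelyReachable⟩

/-! ### The search through the predecessors -/

/-- The full preimage `δ⁻¹(T, a)`. -/
def preimage (δ : Q → A → Q) (T : Finset Q) (a : A) : Finset Q :=
  Finset.univ.filter fun q => δ q a ∈ T

@[simp] theorem mem_preimage {T : Finset Q} {a : A} {q : Q} :
    q ∈ preimage δ T a ↔ δ q a ∈ T := by
  simp [preimage]

/-- `a` maps `δ⁻¹(T, a)` onto `T`, as every state of `T` is of the form `δ(q, a)`. -/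
def IsFull (δ : Q → A → Q) (T : Finset Q) (a : A) : Prop := ∀ p ∈ T, ∃ q, δ q a = p

theorem IsFull.isPredecessor {T : Finset Q} {a : A} (h : IsFull δ T a) :
    IsPredecessor δ (preimage δ T a) T := by
  refine ⟨[a], ?_⟩
  ext p
  simp only [image, act, List.foldl_cons, List.foldl_nil, Finset.mem_image, mem_preimage]
  constructor
  · rintro ⟨q, hq, rfl⟩
    exact hq
  · intro hp
    obtain ⟨q, rfl⟩ := h p hp
    exact ⟨q, hp, rfl⟩

/-- The state of the search: `X 0, …, X (m - 1)` are the sets that have been put on the queue, and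
the first `h` of them have been processed. The values of `X` from `m` on are irrelevant. -/
structure Search (δ : Q → A → Q) (S : Finset Q) (X : ℕ → Finset Q) (h m : ℕ) : Prop where
  start : X 0 = S
  pos : 0 < m
  head_le : h ≤ m
  pred : ∀ j < m, IsPredecessor δ (X j) S
  card : ∀ j < h, (X j).card ≤ S.card
  compl : ∀ i < h, ∀ j < h, X i ≠ X j → Disjoint (X i)ᶜ (X j)ᶜ
  closed : ∀ j < h, ∀ a, IsFull δ (X j) a → ∃ i < m, X i = preimage δ (X j) a

/-- When the queue is empty, every predecessor of `S` has been processed: as no processed set is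
larger than `S`, an `a`-predecessor of a processed set `T` must be all of `δ⁻¹(T, a)`. -/
theorem Search.exists_eq {S : Finset Q} {X : ℕ → Finset Q} {m : ℕ} (hs : Search δ S X m m)
    {T : Finset Q} (hT : IsPredecessor δ T S) : ∃ j < m, X j = T := by
  obtain ⟨w, hw⟩ := hT
  induction w generalizing T with
  | nil =>
    refine ⟨0, hs.pos, ?_⟩
    rw [hs.start, ← hw]
    simp [image, act]
  | cons a w ih =>
    rw [show a :: w = [a] ++ w from rfl, image_append] at hw
    obtain ⟨j, hj, hXj⟩ := ih hw
    have himg : ∀ q ∈ T, δ q a ∈ X j := by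
      intro q hq
      rw [hXj]
      exact Finset.mem_image.2 ⟨q, hq, rfl⟩
    have hfull : IsFull δ (X j) a := by
      intro p hp
      rw [hXj] at hp
      obtain ⟨q, -, hq⟩ := Finset.mem_image.1 hp
      exact ⟨q, hq⟩
    obtain ⟨i, hi, hXi⟩ := hs.closed j hj a hfull
    refine ⟨i, hi, (Finset.eq_of_subset_of_card_le ?_ ?_).symm⟩
    · intro q hq
      rw [hXi, mem_preimage]
      exact himg q hq
    · refine (hs.card i hi).trans (IsPredecessor.card_le (δ := δ) ⟨[a] ++ w, ?_⟩)
      rw [image_append, hw]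

theorem Search.witnessCandidate {S : Finset Q} {X : ℕ → Finset Q} {m : ℕ}
    (hs : Search δ S X m m) (hne : S.Nonempty) (huniv : S ≠ Finset.univ) :
    WitnessCandidate δ S := by
  refine ⟨hne, huniv, fun T hT => ?_, fun T T' hT hT' h => ?_⟩
  · obtain ⟨j, hj, rfl⟩ := hs.exists_eq hT
    exact (hs.card j hj).not_gt
  · obtain ⟨i, hi, rfl⟩ := hs.exists_eq hT
    obtain ⟨j, hj, rfl⟩ := hs.exists_eq hT'
    exact hs.compl i hi j hj h

end

/-! ### Decoding bit strings -/

/-- The bit string that encodes a list of numbers: each number `m` is written as `1ᵐ0`. -/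
def encodeWords (ws : List ℕ) : List Bool :=
  ws.flatMap fun m => List.replicate m true ++ [false]

/-- One step of the decoder. Its state consists of the numbers read so far and of the length of the
current block of ones. -/
def decodeStep (p : List ℕ × ℕ) (b : Bool) : List ℕ × ℕ :=
  if b then (p.1, p.2 + 1) else (p.1 ++ [p.2], 0)

/-- The numbers encoded by a bit string, and the number of ones after its last zero. -/
def decode (l : List Bool) : List ℕ × ℕ := l.foldl decodeStep ([], 0)

theorem decode_concat (l : List Bool) (b : Bool) :
    decode (l ++ [b]) = decodeStep (decode l) b := by
  simp [decode]

theorem encodeWords_decode (l : List Bool) :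
    encodeWords (decode l).1 ++ List.replicate (decode l).2 true = l := by
  induction l using List.reverseRecOn with
  | nil => rfl
  | append_singleton l b ih =>
    rw [decode_concat]
    cases b
    · conv_rhs => rw [← ih]
      simp [decodeStep, encodeWords]
    · simp only [decodeStep, if_true, List.replicate_succ', ← List.append_assoc, ih]

theorem foldl_decodeStep_replicate (ws : List ℕ) (c m : ℕ) :
    (List.replicate m true).foldl decodeStep (ws, c) = (ws, c + m) := by
  induction m generalizing c with
  | zero => rfl
  | succ m ih =>
    rw [List.replicate_succ, List.foldl_cons, decodeStep, if_pos rfl, ih]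
    simp only [Prod.mk.injEq, true_and]
    omega

theorem foldl_decodeStep_encodeWords (ws vs : List ℕ) :
    (encodeWords vs).foldl decodeStep (ws, 0) = (ws ++ vs, 0) := by
  induction vs generalizing ws with
  | nil => simp [encodeWords]
  | cons v vs ih =>
    have : encodeWords (v :: vs) = List.replicate v true ++ ([false] ++ encodeWords vs) := by
      simp [encodeWords]
    rw [this, List.foldl_append, foldl_decodeStep_replicate, List.foldl_append]
    simp [decodeStep, ih]

theorem decode_encodeWords (ws : List ℕ) : decode (encodeWords ws) = (ws, 0) := by
  rw [decode, foldl_decodeStep_encodeWords, List.nil_append]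

theorem length_decode (l : List Bool) :
    (decode l).1.sum + (decode l).1.length + (decode l).2 = l.length := by
  induction l using List.reverseRecOn with
  | nil => rfl
  | append_singleton l b ih =>
    rw [decode_concat]
    cases b <;> simp [decodeStep] <;> omega

theorem getD_decode_le (l : List Bool) (j : ℕ) : (decode l).1.getD j 0 ≤ l.length := by
  have h := length_decode l
  by_cases hj : j < (decode l).1.length
  · rw [List.getD_eq_getElem _ _ hj]
    have := List.le_sum_of_mem (List.getElem_mem hj)
    omega
  · rw [List.getD_eq_default _ _ (not_lt.1 hj)]
    exact Nat.zero_le _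

section

variable {n k : ℕ} (δ : Fin n → Fin k → Fin n)

theorem mul_add_lt (q : Fin n) (a : Fin k) : (a : ℕ) * n + q < k * n :=
  calc (a : ℕ) * n + q < (a + 1) * n := by rw [Nat.succ_mul]; omega
    _ ≤ k * n := Nat.mul_le_mul_right _ a.2

theorem divNat_mk (q : Fin n) (a : Fin k) :
    (⟨a * n + q, mul_add_lt q a⟩ : Fin (k * n)).divNat = a :=
  Fin.ext (by
    change (a * n + q : ℕ) / n = a
    rw [Nat.add_comm, Nat.add_mul_div_right _ _ q.pos, Nat.div_eq_of_lt q.2,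
      Nat.zero_add])

theorem modNat_mk (q : Fin n) (a : Fin k) :
    (⟨a * n + q, mul_add_lt q a⟩ : Fin (k * n)).modNat = q :=
  Fin.ext (by
    change (a * n + q : ℕ) % n = q
    rw [Nat.add_comm, Nat.add_mul_mod_self_right, Nat.mod_eq_of_lt q.2])

/-- Cell `a * n + q` of the transition table holds `δ(q, a)`: in `Fin (k * n)`, this index has the
quotient `a` and the remainder `q`. -/
theorem toWords_eq_ofFn : toWords δ =
    n :: k :: List.ofFn fun i : Fin (k * n) => (δ i.modNat i.divNat : ℕ) := by
  rw [toWords, List.ofFn_mul, List.flatMap, List.ofFn_eq_map]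
  congr 4
  funext a
  rw [List.ofFn_eq_map]
  congr 1
  funext q
  rw [modNat_mk, divNat_mk]

theorem length_toWords : (toWords δ).length = k * n + 2 := by
  simp [toWords_eq_ofFn]

theorem getD_toWords (q : Fin n) (a : Fin k) : (toWords δ).getD (a * n + q + 2) 0 = δ q a := by
  simp only [toWords_eq_ofFn, List.getD_cons_succ]
  rw [List.getD_eq_getElem _ _ (by simpa using mul_add_lt q a), List.getElem_ofFn, modNat_mk,
    divNat_mk]

theorem getD_toWords_lt {i : ℕ} (hi : i < k * n) : (toWords δ).getD (i + 2) 0 < n := by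
  simp [toWords_eq_ofFn, hi]

end

/-- The list consists of two numbers `n`, `k` and `k * n` numbers below `n`. The default value of
`getD` does no harm, as the first condition forces the list to have at least two entries. -/
def IsTable (ws : List ℕ) : Prop :=
  ws.length = ws.getD 1 0 * ws.getD 0 0 + 2 ∧
    ∀ i < ws.getD 1 0 * ws.getD 0 0, ws.getD (i + 2) 0 < ws.getD 0 0

theorem isTable_toWords {n k : ℕ} (δ : Fin n → Fin k → Fin n) : IsTable (toWords δ) :=
  ⟨length_toWords δ, fun _ hi => getD_toWords_lt δ hi⟩

theorem IsTable.exists_eq {ws : List ℕ} {n k : ℕ} (h : IsTable ws) (hn : ws.getD 0 0 = n)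
    (hk : ws.getD 1 0 = k) : ∃ δ : Fin n → Fin k → Fin n, toWords δ = ws := by
  obtain ⟨hl, hlt⟩ := h
  rw [hn, hk] at hl hlt
  obtain _ | ⟨n', _ | ⟨k', vs⟩⟩ := ws
  · simp at hl
  · simp at hl
  simp at hn hk hl hlt
  subst hn hk
  refine ⟨fun q a => ⟨vs[(a * n' + q : ℕ)]?.getD 0, hlt _ (mul_add_lt q a)⟩, ?_⟩
  rw [toWords_eq_ofFn]
  congr 2
  refine List.ext_getElem (by simp [hl]) fun i h1 h2 => ?_
  simp [Nat.div_add_mod', h2]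

theorem encode_eq_iff {n k : ℕ} {δ : Fin n → Fin k → Fin n} {x : List Bool} :
    x = encode δ ↔ (decode x).2 = 0 ∧ (decode x).1 = toWords δ := by
  constructor
  · rintro rfl
    have : decode (encode δ) = (toWords δ, 0) := decode_encodeWords _
    rw [this]
    exact ⟨rfl, rfl⟩
  · rintro ⟨h0, h1⟩
    rw [← encodeWords_decode x, h0, h1]
    exact List.append_nil _

theorem encode_injective {n k n' k' : ℕ} {δ : Fin n → Fin k → Fin n}
    {δ' : Fin n' → Fin k' → Fin n'} (h : encode δ = encode δ') :
    (⟨n, k, δ⟩ : Σ n k, Fin n → Fin k → Fin n) = ⟨n', k', δ'⟩ := by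
  have hw : toWords δ = toWords δ' := by
    rw [← (encode_eq_iff.1 h).2, ← (encode_eq_iff.1 (rfl : encode δ = encode δ)).2]
  have h2 := hw
  simp only [toWords, List.cons.injEq] at h2
  obtain ⟨rfl, rfl, -⟩ := h2
  congr 2
  funext q a
  apply Fin.ext
  rw [← getD_toWords, hw, getD_toWords]

end Automaton

/-! ### The queue and the array `Absent` -/

namespace IsWitnessCandidate

open RAM RAM.Expr RAM.Cmd Automaton

attribute [local simp] ansV nV kV headV tailV curV sizeSV sizeTV oldV flagV qV aV baseV deltaA
  inputA queueA absentA hitA Expr.eval Expr.cost setVar_var setArr_arr Function.update_apply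

variable {n k : ℕ} {δ : Fin n → Fin k → Fin n} {S : Finset (Fin n)}

theorem forall_val_le_iff {p : Fin n → Prop} {i : ℕ} (hi : i < n) :
    (∀ q : Fin n, (q : ℕ) ≤ i → p q) ↔ (∀ q : Fin n, (q : ℕ) < i → p q) ∧ p ⟨i, hi⟩ := by
  constructor
  · exact fun h => ⟨fun q hq => h q hq.le, h _ le_rfl⟩
  · rintro ⟨h, h'⟩ q hqi
    rcases Nat.lt_or_eq_of_le hqi with hlt | heq
    · exact h q hlt
    · rwa [show q = ⟨i, hi⟩ from Fin.ext heq]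

/-- The number of states `q < i` in `T`. -/
def cardBelow (T : Finset (Fin n)) (i : ℕ) : ℕ := (T.filter fun q : Fin n => (q : ℕ) < i).card

@[simp] theorem cardBelow_zero (T : Finset (Fin n)) : cardBelow T 0 = 0 := by
  simp [cardBelow]

theorem cardBelow_succ (T : Finset (Fin n)) {i : ℕ} (hi : i < n) :
    cardBelow T (i + 1) = cardBelow T i + if (⟨i, hi⟩ : Fin n) ∈ T then 1 else 0 := by
  have h : ∀ q : Fin n, (q : ℕ) < i + 1 ↔ (q : ℕ) < i ∨ q = ⟨i, hi⟩ := by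
    intro q
    rw [Fin.ext_iff]
    exact Nat.lt_succ_iff_lt_or_eq
  simp only [cardBelow, h]
  rw [Finset.filter_or, Finset.card_union_of_disjoint]
  · congr 1
    split_ifs with hT
    · rw [Finset.card_eq_one]
      exact ⟨⟨i, hi⟩, by ext; simp +contextual [hT]⟩
    · rw [Finset.card_eq_zero]
      ext q
      simp only [Finset.mem_filter, Finset.notMem_empty, iff_false, not_and]
      rintro hq rfl
      exact hT hq
  · rw [Finset.disjoint_left]
    intro q hq hq'
    have h1 := (Finset.mem_filter.1 hq).2
    rw [(Finset.mem_filter.1 hq').2] at h1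
    exact lt_irrefl _ h1

theorem cardBelow_self (T : Finset (Fin n)) : cardBelow T n = T.card := by
  rw [cardBelow]
  congr 1
  ext q
  simp

/-- The cells from address `p` on hold the characteristic vector of `T`. -/
def Stores (s : State) (p : ℕ) (T : Finset (Fin n)) : Prop :=
  ∀ q : Fin n, s.arr queueA (p + q) = if q ∈ T then 1 else 0

/-- The state `s` of the machine represents the state `X`, `h`, `m` of the search: the queue holds
`X j` at the address `j * n`, and `Absent[q]` refers to a processed set that lacks `q`, or is none
if there is no such set. -/
structure Represents (δ : Fin n → Fin k → Fin n) (S : Finset (Fin n)) (X : ℕ → Finset (Fin n))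
    (h m : ℕ) (s : State) : Prop where
  n_eq : s.var nV = n
  k_eq : s.var kV = k
  delta : ∀ (q : Fin n) (a : Fin k), s.arr deltaA (a * n + q) = δ q a
  size : s.var sizeSV = S.card
  head : s.var headV = h * n
  tail : s.var tailV = m * n
  stores : ∀ j < m, Stores s (j * n) (X j)
  absent : ∀ q : Fin n, (s.arr absentA q = 0 ∧ ∀ j < h, q ∈ X j) ∨
    ∃ j < h, s.arr absentA q = j * n + 1 ∧ q ∉ X j
  search : Search δ S X h m

theorem run_pushInput {s : State} (hs : HasInput δ S s) :
    Run pushInput s fun t s' => t ≤ 24 * n + 20 ∧ s'.var ansV = 1 ∧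
      Represents δ S (fun _ => S) 0 1 s' := by
  obtain ⟨hn, hk, hδ, hS⟩ := hs
  simp only [pushInput, block_cons, block_nil, run_seq, run_set]
  refine run_forLoop (fun i s' => s'.var sizeSV = cardBelow S i ∧
    ∀ q : Fin n, (q : ℕ) < i → s'.arr queueA q = (if q ∈ S then 1 else 0) ∧
      s'.arr absentA q = 0) 13 n (by simp [hn]) rfl rfl (by simp) ?_ ?_
  · rintro i s' hi hq hag ⟨h1, h2⟩
    have hin : s'.arr inputA = s.arr inputA := hag.arr inputA rfl
    have hSi := hS ⟨i, hi⟩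
    simp [hq, hin] at hSi h1 h2 ⊢
    rw [cardBelow_succ S hi, h1, hSi]
    refine ⟨rfl, fun q hqi => ?_⟩
    by_cases h : (q : ℕ) = i
    · have h' : q = ⟨i, hi⟩ := Fin.ext h
      subst h'
      simp
    · have := h2 q (by omega)
      simp [h, this.1, this.2]
  · rintro t s' ht hag ⟨h1, h2⟩
    have e1 := hag.var 1 rfl
    have e2 := hag.var 2 rfl
    have e3 := hag.var 3 rfl
    have e4 := hag.var 4 rfl
    have e0 := hag.var 0 rfl
    have e5 := hag.arr 0 rfl
    simp at e0 e1 e2 e3 e4 e5 hδ h1 h2 hn hk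
    simp only [run_skip, Expr.cost]
    refine ⟨by omega, e0, ?_⟩
    refine ⟨e1.trans hn, e2.trans hk, by simpa [e5] using hδ, h1.trans (cardBelow_self S),
      by simpa using e3, by simpa [hn] using e4, ?_, ?_, ?_⟩
    · intro j hj q
      obtain rfl : j = 0 := by omega
      simpa using (h2 q).1
    · intro q
      exact .inl ⟨(h2 q).2, fun j hj => absurd hj (by omega)⟩
    · exact ⟨rfl, one_pos, zero_le_one, fun _ _ => .refl _, fun j hj => absurd hj (by omega),
        fun j hj => absurd hj (by omega), fun j hj => absurd hj (by omega)⟩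

/-- Register `oldV` is zero if `Absent` is none at all states outside `T`; otherwise it holds the
entry of `Absent` at one of them. -/
theorem run_popNext {X : ℕ → Finset (Fin n)} {h m : ℕ} {s : State}
    (hs : Represents δ S X h m s) (hh : h < m) :
    Run popNext s fun t s' => t ≤ 28 * n + 20 ∧ s'.var curV = h * n ∧
      s'.var headV = (h + 1) * n ∧ s'.var sizeTV = (X h).card ∧
      ((s'.var oldV = 0 ∧ ∀ q ∉ X h, s.arr absentA q = 0) ∨
        ∃ q ∉ X h, s.arr absentA q = s'.var oldV ∧ s'.var oldV ≠ 0) := by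
  have hn := hs.n_eq
  have hhd := hs.head
  have hst := hs.stores h hh
  simp only [popNext, block_cons, block_nil, run_seq, run_set]
  refine run_forLoop (fun i s' => s'.var sizeTV = cardBelow (X h) i ∧
      ((s'.var oldV = 0 ∧ ∀ q : Fin n, (q : ℕ) < i → q ∉ X h → s.arr absentA q = 0) ∨
        ∃ q ∉ X h, s.arr absentA q = s'.var oldV ∧ s'.var oldV ≠ 0)) 17 n (by simpa using hn)
        rfl rfl (by simp) ?_ ?_
  · rintro i s' hi hq hag ⟨h1, h2⟩
    have e2 := hag.arr 2 rfl
    have e3 := hag.arr 3 rfl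
    have e5 := hag.var 5 rfl
    have hsti := hst ⟨i, hi⟩
    simp at e2 e3 e5 hsti hhd h1 h2 hq
    rw [hhd] at e5
    simp [hq, e2, e3, e5, hsti]
    rw [cardBelow_succ (X h) hi, h1]
    by_cases hX : (⟨i, hi⟩ : Fin n) ∈ X h
    · simp [hX]
      refine h2.imp (fun h2 => ⟨h2.1, fun q hqi hqX => h2.2 q ?_ hqX⟩) id
      refine lt_of_le_of_ne hqi fun heq => hqX ?_
      rwa [show q = ⟨i, hi⟩ from Fin.ext heq]
    · simp [hX]
      constructor
      · intro hne
        exact .inr ⟨⟨i, hi⟩, hX, rfl, hne⟩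
      · intro h0
        refine h2.imp (fun h2 => ⟨h2.1, fun q hqi hqX => ?_⟩) id
        rcases Nat.lt_or_eq_of_le hqi with hlt | heq
        · exact h2.2 q hlt hqX
        · rwa [heq]
  · rintro t s' ht hag ⟨h1, h2⟩
    have e5 := hag.var 5 rfl
    have e3 := hag.var 3 rfl
    simp at e5 e3 hhd hn
    simp only [run_skip, Expr.cost]
    refine ⟨by omega, e5.trans hhd, ?_, h1.trans (cardBelow_self _), ?_⟩
    · exact e3.trans (by rw [hhd, hn]; ring)
    · exact h2.imp (fun h2 => ⟨h2.1, fun q hq => h2.2 q q.2 hq⟩) id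

theorem run_compareWithOld {s : State} {p p' : ℕ} {T T' : Finset (Fin n)} (hn : s.var nV = n)
    (hp : s.var curV = p) (hp' : s.var oldV = p' + 1) (hT : Stores s p T) (hT' : Stores s p' T') :
    Run compareWithOld s fun t s' => t ≤ 28 * n + 20 ∧ (s'.var flagV ≠ 0 ↔ T = T') := by
  simp only [compareWithOld, block_cons, block_nil, run_seq, run_set]
  refine run_forLoop (fun i s' => s'.var flagV ≠ 0 ↔
    ∀ q : Fin n, (q : ℕ) < i → (q ∈ T ↔ q ∈ T')) 19 n (by simpa using hn)
      rfl rfl (by simp) ?_ ?_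
  · rintro i s' hi hq hag h1
    have e2 := hag.arr 2 rfl
    have e5 := hag.var 5 rfl
    have e8 := hag.var 8 rfl
    have hTi := hT ⟨i, hi⟩
    have hTi' := hT' ⟨i, hi⟩
    simp at e2 e5 e8 hTi hTi' hp hp' h1 hq
    simp [hq, e2, e5, e8, hp, hp', hTi, hTi']
    rw [forall_val_le_iff hi]
    by_cases hX : (⟨i, hi⟩ : Fin n) ∈ T <;> by_cases hX' : (⟨i, hi⟩ : Fin n) ∈ T' <;>
      simp [hX, hX', h1]
    all_goals exact ⟨⟨i, hi⟩, le_rfl, by simp [hX, hX']⟩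
  · rintro t s' ht hag h1
    simp only [run_skip, Expr.cost]
    refine ⟨by omega, h1.trans ?_⟩
    rw [Finset.ext_iff]
    exact ⟨fun h q => h q q.2, fun h q _ => h q⟩

theorem run_markAbsent {s : State} {p : ℕ} {T : Finset (Fin n)} (hn : s.var nV = n)
    (hp : s.var curV = p) (hT : Stores s p T) :
    Run markAbsent s fun t s' => t ≤ 21 * n + 20 ∧
      ∀ q : Fin n, s'.arr absentA q = if q ∈ T then s.arr absentA q else p + 1 := by
  simp only [markAbsent]
  refine run_forLoop (fun i s' => ∀ q : Fin n, s'.arr absentA q =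
    if q ∈ T ∨ i ≤ q then s.arr absentA q else p + 1) 12 n hn rfl rfl (by simp) ?_ ?_
  · rintro i s' hi hq hag h1
    have e2 := hag.arr 2 rfl
    have e5 := hag.var 5 rfl
    have hTi := hT ⟨i, hi⟩
    simp at e2 e5 hTi hp h1 hq
    simp [hq, e2, e5, hp, hTi]
    constructor
    · intro hX q
      rw [h1]
      by_cases heq : (q : ℕ) = i
      · rw [show q = ⟨i, hi⟩ from Fin.ext heq]
        simp [hX]
      · simp [show i < (q : ℕ) ↔ i ≤ q by omega]
    · intro hX q
      by_cases heq : (q : ℕ) = i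
      · rw [show q = ⟨i, hi⟩ from Fin.ext heq]
        simp [hX]
      · simp [heq, h1, show i < (q : ℕ) ↔ i ≤ q by omega]
  · rintro t s' ht hag h1
    refine ⟨by omega, fun q => ?_⟩
    simpa [not_le.2 q.2] using h1 q

/-- The body of the loop over the letters in `pushPredecessors`. -/
def tryLetter : List Cmd := [
    forLoop qV (var nV) [put hitA (var qV) (lit 0)],
    forLoop qV (var nV) [
      put queueA (add (var tailV) (var qV))
        (get queueA (add (var curV) (get deltaA (add (var baseV) (var qV))))),
      put hitA (get deltaA (add (var baseV) (var qV))) (lit 1)],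
    set flagV (lit 1),
    forLoop qV (var nV) [
      ite (and (get queueA (add (var curV) (var qV))) (eq (get hitA (var qV)) (lit 0)))
        (set flagV (lit 0)) skip],
    ite (var flagV) (set tailV (add (var tailV) (var nV))) skip,
    set baseV (add (var baseV) (var nV))]

/-- One letter: `δ⁻¹(T, a)` is always written behind the queue, but the end of the queue moves only
if `δ⁻¹(T, a)` is an `a`-predecessor. -/
theorem run_tryLetter {s : State} {h m : ℕ} {T : Finset (Fin n)} (a : Fin k)
    (hn : s.var nV = n) (hδ : ∀ q : Fin n, s.arr deltaA (a * n + q) = δ q a)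
    (hcur : s.var curV = h * n) (htail : s.var tailV = m * n) (hbase : s.var baseV = a * n)
    (hh : h < m) (hT : Stores s (h * n) T) :
    Run (block tryLetter) s fun t s' => t ≤ 63 * n + 80 ∧ s'.var baseV = (a + 1) * n ∧
      (∀ c < m * n, s'.arr queueA c = s.arr queueA c) ∧
      Stores s' (m * n) (preimage δ T a) ∧
      (IsFull δ T a ∧ s'.var tailV = (m + 1) * n ∨ ¬ IsFull δ T a ∧ s'.var tailV = m * n) := by
  have hlt : ∀ q : Fin n, h * n + q < m * n := fun q =>
    calc h * n + q < (h + 1) * n := by rw [Nat.succ_mul]; omega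
      _ ≤ m * n := Nat.mul_le_mul_right n hh
  simp only [tryLetter, block_cons, block_nil, run_seq, run_set]
  refine run_forLoop (fun i s' => ∀ q : Fin n, (q : ℕ) < i → s'.arr hitA q = 0) 4 n hn
    rfl rfl (by simp) ?_ ?_
  · rintro i s' hi hq - h1
    simp at hq h1 ⊢
    intro q hqi hne
    exact h1 q (hq ▸ by omega)
  rintro t₁ s₁ ht₁ hag₁ h₁
  have n₁ := hag₁.var 1 rfl
  have c₁ := hag₁.var 5 rfl
  have ta₁ := hag₁.var 4 rfl
  have b₁ := hag₁.var 12 rfl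
  have δ₁ := hag₁.arr 0 rfl
  have q₁ := hag₁.arr 2 rfl
  refine run_forLoop (fun i s' => (∀ c < m * n, s'.arr queueA c = s.arr queueA c) ∧
    (∀ q : Fin n, (q : ℕ) < i → s'.arr queueA (m * n + q) = if δ q a ∈ T then 1 else 0) ∧
    ∀ p : Fin n, s'.arr hitA p ≠ 0 ↔ ∃ q : Fin n, (q : ℕ) < i ∧ δ q a = p) 18 n (n₁.trans hn)
    rfl rfl ?_ ?_ ?_
  · simp at h₁ q₁ ⊢
    exact ⟨by simp [q₁], h₁⟩
  · rintro i s' hi hq hag ⟨h1, h2, h3⟩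
    have e5 := (hag.var 5 rfl).trans c₁
    have e4 := (hag.var 4 rfl).trans ta₁
    have e12 := (hag.var 12 rfl).trans b₁
    have e0 := (hag.arr 0 rfl).trans δ₁
    have hδi := hδ ⟨i, hi⟩
    have hTi := hT (δ ⟨i, hi⟩ a)
    have h1i := h1 _ (hlt (δ ⟨i, hi⟩ a))
    simp at e5 e4 e12 e0 hδi hTi hcur htail hbase hq h1 h2 h3 h1i
    simp [hq, e5, e4, e12, e0, hcur, htail, hbase, hδi, h1i, hTi]
    refine ⟨fun c hc => ?_, fun q hqi => ?_, fun p => ?_⟩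
    · rw [if_neg (by omega), h1 c hc]
    · by_cases heq : (q : ℕ) = i
      · rw [show q = ⟨i, hi⟩ from Fin.ext heq]
        simp
      · rw [if_neg heq]
        exact h2 q (by omega)
    · by_cases heq : (p : ℕ) = (δ ⟨i, hi⟩ a : ℕ)
      · simp only [heq, if_true, one_ne_zero, not_false_eq_true, true_iff]
        exact ⟨⟨i, hi⟩, le_rfl, (Fin.ext heq).symm⟩
      · rw [if_neg heq, h3]
        refine exists_congr fun q => and_congr_left fun hqp => ?_
        rw [Nat.le_iff_lt_or_eq]
        refine (or_iff_left fun hqi => heq ?_).symm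
        rw [← hqp, show q = ⟨i, hi⟩ from Fin.ext hqi]
  rintro t₂ s₂ ht₂ hag₂ ⟨hq₂, hp₂, hh₂⟩
  have n₂ := ((hag₂.var 1 rfl).trans n₁).trans hn
  have c₂ := ((hag₂.var 5 rfl).trans c₁).trans hcur
  have ta₂ := ((hag₂.var 4 rfl).trans ta₁).trans htail
  have b₂ := ((hag₂.var 12 rfl).trans b₁).trans hbase
  refine run_forLoop (fun i s' => s'.var flagV ≠ 0 ↔ ∀ p : Fin n, (p : ℕ) < i → p ∈ T →
    ∃ q : Fin n, δ q a = p) 14 n (by simpa using n₂)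
    rfl rfl (by simp) ?_ ?_
  · rintro i s' hi hq hag h1
    have e5 := hag.var 5 rfl
    have e2 := hag.arr 2 rfl
    have e4 := hag.arr 4 rfl
    have hTi := hT ⟨i, hi⟩
    have h2i := hq₂ _ (hlt ⟨i, hi⟩)
    have h4i := hh₂ ⟨i, hi⟩
    simp at e5 e2 e4 hTi h2i h4i h1 c₂ hq
    simp [hq, e5, e2, e4, c₂, h2i, hTi]
    rw [forall_val_le_iff hi]
    by_cases hX : (⟨i, hi⟩ : Fin n) ∈ T
    · by_cases hit : s₂.arr 4 i = 0
      · have : ¬ ∃ q : Fin n, δ q a = ⟨i, hi⟩ := by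
          exact fun h => h4i.2 h hit
        simp [hX, hit, this]
        exact ⟨⟨i, hi⟩, le_rfl, hX, not_exists.1 this⟩
      · have : ∃ q : Fin n, δ q a = ⟨i, hi⟩ := h4i.1 hit
        simp [hX, hit, this, h1]
    · simp [hX, h1]
  rintro t₃ s₃ ht₃ hag₃ h₃
  have n₃ := (hag₃.var 1 rfl).trans n₂
  have ta₃ := (hag₃.var 4 rfl).trans ta₂
  have b₃ := (hag₃.var 12 rfl).trans b₂
  have q₃ := hag₃.arr 2 rfl
  simp at n₃ ta₃ b₃ q₃ hq₂ hp₂ h₃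
  have hfull : s₃.var 9 ≠ 0 ↔ IsFull δ T a := by
    rw [Ne, h₃]
    rfl
  simp [n₃, ta₃, b₃, q₃, ← hfull]
  have hst : ∀ s', s'.arr 2 = s₂.arr 2 → Stores s' (m * n) (preimage δ T a) := by
    intro s' hs' q
    simp [hs', hp₂ q]
  constructor
  · intro hne
    refine ⟨by omega, by ring, hq₂, hst _ (by simp [q₃]), .inl ⟨hne, by ring⟩⟩
  · intro he
    refine ⟨by omega, by ring, hq₂, hst _ (by simp [q₃]), .inr he⟩

/-- The sets on the queue stay in place, and the new ones are predecessors of the processed set `X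
h` that include all its full `a`-predecessors. -/
theorem run_pushPredecessors {s : State} {X : ℕ → Finset (Fin n)} {h m : ℕ}
    (hn : s.var nV = n) (hk : s.var kV = k)
    (hδ : ∀ (q : Fin n) (a : Fin k), s.arr deltaA (a * n + q) = δ q a)
    (hcur : s.var curV = h * n) (htail : s.var tailV = m * n) (hh : h < m)
    (hX : ∀ j < m, Stores s (j * n) (X j)) :
    Run pushPredecessors s fun t s' => t ≤ k * (63 * n + 80 + 9) + 20 ∧
      ∃ (X' : ℕ → Finset (Fin n)) (m' : ℕ), m ≤ m' ∧ m' ≤ m + k ∧ s'.var tailV = m' * n ∧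
        (∀ j < m, X' j = X j) ∧ (∀ j < m', Stores s' (j * n) (X' j)) ∧
        (∀ j < m', m ≤ j → IsPredecessor δ (X' j) (X h)) ∧
        ∀ a, IsFull δ (X h) a → ∃ j < m', X' j = preimage δ (X h) a := by
  change Run (block [set baseV (lit 0), forLoop aV (var kV) tryLetter]) s _
  simp only [block_cons, block_nil, run_seq, run_set]
  refine run_forLoop (fun i s' => s'.var baseV = i * n ∧
    ∃ (X' : ℕ → Finset (Fin n)) (m' : ℕ), m ≤ m' ∧ m' ≤ m + i ∧ s'.var tailV = m' * n ∧
        (∀ j < m, X' j = X j) ∧ (∀ j < m', Stores s' (j * n) (X' j)) ∧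
        (∀ j < m', m ≤ j → IsPredecessor δ (X' j) (X h)) ∧
        ∀ a : Fin k, (a : ℕ) < i → IsFull δ (X h) a → ∃ j < m', X' j = preimage δ (X h) a)
    (63 * n + 80) k (by simpa using hk) rfl rfl ?_ ?_ ?_
  · refine ⟨by simp, X, m, le_rfl, le_rfl, by simpa using htail, fun _ _ => rfl, hX,
      fun j hj hj' => absurd hj (by omega), fun a ha => absurd ha (by omega)⟩
  · rintro i s' hi hq hag ⟨h1, X', m', hm, hmi, htl, hX', hst, hpred, hcl⟩
    have e1 := hag.var 1 rfl
    have e5 := hag.var 5 rfl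
    have e0 := hag.arr 0 rfl
    simp at e1 e5 e0 hn hcur hδ
    refine (run_tryLetter (δ := δ) (s := s') (h := h) (m := m') (T := X h) ⟨i, hi⟩ (e1.trans hn)
      (fun q => by simpa [e0] using hδ q ⟨i, hi⟩) (e5.trans hcur) htl h1 (by omega)
      (hX' h hh ▸ hst h (by omega))).mono ?_
    rintro t s'' ⟨ht, hb, hq, hnew, hfull⟩
    have hkeep : ∀ j < m', Stores s'' (j * n) (X' j) := by
      intro j hj q
      rw [hq, hst j hj q]
      calc j * n + q < (j + 1) * n := by rw [Nat.succ_mul]; omega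
        _ ≤ m' * n := Nat.mul_le_mul_right n hj
    refine ⟨ht, by simpa using hb, ?_⟩
    rcases hfull with ⟨hf, htl'⟩ | ⟨hf, htl'⟩
    · refine ⟨Function.update X' m' (preimage δ (X h) ⟨i, hi⟩), m' + 1, by omega, by omega,
        by simpa using htl', fun j hj => ?_, fun j hj => ?_, fun j hj hj' => ?_,
        fun a ha haf => ?_⟩
      · rw [Function.update_of_ne (by omega), hX' j hj]
      · rcases Nat.lt_succ_iff_lt_or_eq.1 hj with hj | rfl
        · rw [Function.update_of_ne (by omega)]
          exact hkeep j hj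
        · rw [Function.update_self]
          exact hnew
      · rcases Nat.lt_succ_iff_lt_or_eq.1 hj with hj | rfl
        · rw [Function.update_of_ne (by omega)]
          exact hpred j hj hj'
        · rw [Function.update_self]
          exact hf.isPredecessor
      · rcases Nat.lt_succ_iff_lt_or_eq.1 ha with ha | rfl
        · obtain ⟨j, hj, hjX⟩ := hcl a ha haf
          exact ⟨j, by omega, by rw [Function.update_of_ne (by omega), hjX]⟩
        · exact ⟨m', by omega, Function.update_self _ _ _⟩
    · refine ⟨X', m', hm, by omega, by simpa using htl', hX', hkeep, hpred,
        fun a ha haf => ?_⟩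
      rcases Nat.lt_succ_iff_lt_or_eq.1 ha with ha | rfl
      · exact hcl a ha haf
      · exact absurd haf hf
  · rintro t s' ht hag ⟨-, X', m', hm, hmi, htl, hX', hst, hpred, hcl⟩
    simp only [run_skip, Expr.cost]
    exact ⟨by omega, X', m', hm, hmi, htl, hX', hst, hpred, fun a => hcl a a.2⟩

/-! ### Correctness and running time of the algorithm -/

/-- The number of states at which `Absent` is none. -/
def unmarked (n : ℕ) (s : State) : ℕ :=
  (Finset.univ.filter fun q : Fin n => s.arr absentA q = 0).card

/-- An iteration that skips a set that was processed before. -/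
theorem Represents.skip {X : ℕ → Finset (Fin n)} {h m j : ℕ} {s s' : State}
    (hs : Represents δ S X h m s) (hh : h < m) (hj : j < h) (hX : X h = X j)
    (hvar : ∀ v ∈ [nV, kV, sizeSV, tailV], s'.var v = s.var v)
    (harr : ∀ a ∈ [deltaA, queueA, absentA], s'.arr a = s.arr a)
    (hhead : s'.var headV = (h + 1) * n) :
    Represents δ S X (h + 1) m s' where
  n_eq := (hvar _ (by simp)).trans hs.n_eq
  k_eq := (hvar _ (by simp)).trans hs.k_eq
  delta := by
    rw [harr deltaA (by simp)]
    exact hs.delta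
  size := (hvar _ (by simp)).trans hs.size
  head := hhead
  tail := (hvar _ (by simp)).trans hs.tail
  stores i hi q := by
    rw [harr queueA (by simp)]
    exact hs.stores i hi q
  absent q := by
    rw [harr absentA (by simp)]
    refine (hs.absent q).imp (fun ⟨h0, hq⟩ => ⟨h0, fun i hi => ?_⟩)
      fun ⟨i, hi, h'⟩ => ⟨i, by omega, h'⟩
    rcases Nat.lt_succ_iff_lt_or_eq.1 hi with hi | rfl
    · exact hq i hi
    · exact hX ▸ hq j hj
  search := by
    -- The set `X h` occurs among the sets processed before, so that every condition is inherited.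
    have key : ∀ i < h + 1, ∃ i' < h, X i = X i' := by
      intro i hi
      rcases Nat.lt_succ_iff_lt_or_eq.1 hi with hi | rfl
      · exact ⟨i, hi, rfl⟩
      · exact ⟨j, hj, hX⟩
    refine ⟨hs.search.start, hs.search.pos, hh, hs.search.pred, fun i hi => ?_,
      fun i hi i' hi' hne => ?_, fun i hi a ha => ?_⟩
    · obtain ⟨l, hl, e⟩ := key i hi
      exact e ▸ hs.search.card l hl
    · obtain ⟨l, hl, e⟩ := key i hi
      obtain ⟨l', hl', e'⟩ := key i' hi'
      rw [e, e'] at hne ⊢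
      exact hs.search.compl l hl l' hl' hne
    · obtain ⟨l, hl, e⟩ := key i hi
      rw [e] at ha ⊢
      exact hs.search.closed l hl a ha

/-- An iteration that processes a new set `X h`. -/
theorem Represents.process {X X' : ℕ → Finset (Fin n)} {h m m' : ℕ} {s s' : State}
    (hs : Represents δ S X h m s) (hh : h < m) (hcard : (X h).card ≤ S.card)
    (hnew : ∀ q ∉ X h, s.arr absentA q = 0)
    (hvar : ∀ v ∈ [nV, kV, sizeSV], s'.var v = s.var v)
    (harr : s'.arr deltaA = s.arr deltaA)
    (hhead : s'.var headV = (h + 1) * n) (htail : s'.var tailV = m' * n)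
    (hm : m ≤ m') (hX : ∀ j < m, X' j = X j) (hst : ∀ j < m', Stores s' (j * n) (X' j))
    (habs : ∀ q : Fin n, s'.arr absentA q = if q ∈ X h then s.arr absentA q else h * n + 1)
    (hpred : ∀ j < m', m ≤ j → IsPredecessor δ (X' j) (X h))
    (hcl : ∀ a, IsFull δ (X h) a → ∃ j < m', X' j = preimage δ (X h) a) :
    Represents δ S X' (h + 1) m' s' where
  n_eq := (hvar _ (by simp)).trans hs.n_eq
  k_eq := (hvar _ (by simp)).trans hs.k_eq
  delta := by
    rw [harr]
    exact hs.delta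
  size := (hvar _ (by simp)).trans hs.size
  head := hhead
  tail := htail
  stores := hst
  absent q := by
    rw [habs]
    split_ifs with hq
    · refine (hs.absent q).imp (fun ⟨h0, hq'⟩ => ⟨h0, fun i hi => ?_⟩)
        fun ⟨i, hi, h'⟩ => ⟨i, by omega, by rwa [hX i (by omega)]⟩
      rw [hX i (by omega)]
      rcases Nat.lt_succ_iff_lt_or_eq.1 hi with hi | rfl
      · exact hq' i hi
      · exact hq
    · exact .inr ⟨h, by omega, rfl, by rwa [hX h hh]⟩
  search := by
    -- `Absent` is none at all states outside `X h`, so every earlier set contains these states.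
    have hdisj : ∀ i < h, Disjoint (X h)ᶜ (X i)ᶜ := by
      intro i hi
      rw [Finset.disjoint_left]
      intro q hq hq'
      rw [Finset.mem_compl] at hq hq'
      rcases hs.absent q with ⟨-, hall⟩ | ⟨j, hj, h', -⟩
      · exact hq' (hall i hi)
      · exact absurd (hnew q hq) (by omega)
    refine ⟨(hX 0 hs.search.pos).trans hs.search.start, hs.search.pos.trans_le hm,
      by omega, fun i hi => ?_, fun i hi => ?_, fun i hi j hj hne => ?_, fun i hi a ha => ?_⟩
    · by_cases him : i < m
      · exact hX i him ▸ hs.search.pred i him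
      · exact (hpred i hi (by omega)).trans (hs.search.pred h hh)
    · rw [hX i (by omega)]
      rcases Nat.lt_succ_iff_lt_or_eq.1 hi with hi | rfl
      · exact hs.search.card i hi
      · exact hcard
    · rw [hX i (by omega), hX j (by omega)] at hne ⊢
      rcases Nat.lt_succ_iff_lt_or_eq.1 hi with hi | rfl
      · rcases Nat.lt_succ_iff_lt_or_eq.1 hj with hj | rfl
        · exact hs.search.compl i hi j hj hne
        · exact (hdisj i hi).symm
      · rcases Nat.lt_succ_iff_lt_or_eq.1 hj with hj | rfl
        · exact hdisj j hj
        · exact absurd rfl hne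
    · rw [hX i (by omega)] at ha ⊢
      rcases Nat.lt_succ_iff_lt_or_eq.1 hi with hi | rfl
      · obtain ⟨j, hj, hje⟩ := hs.search.closed i hi a ha
        exact ⟨j, by omega, by rw [hX j hj, hje]⟩
      · exact hcl a ha

/-- Processing a new set marks at least one more state. -/
theorem unmarked_lt {T : Finset (Fin n)} {s s' : State} {v : ℕ} (hT : T ≠ Finset.univ)
    (hnew : ∀ q ∉ T, s.arr absentA q = 0)
    (habs : ∀ q : Fin n, s'.arr absentA q = if q ∈ T then s.arr absentA q else v + 1) :
    unmarked n s' < unmarked n s := by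
  obtain ⟨q, hq⟩ := not_forall.1 (mt Finset.eq_univ_iff_forall.2 hT)
  refine Finset.card_lt_card (Finset.ssubset_iff_subset_ne.2 ⟨fun p hp => ?_, fun heq => ?_⟩)
  · have hp := (Finset.mem_filter.1 hp).2
    refine Finset.mem_filter.2 ⟨Finset.mem_univ _, ?_⟩
    by_cases hpT : p ∈ T
    · rwa [habs, if_pos hpT] at hp
    · exact hnew p hpT
  · have hmem : q ∈ Finset.univ.filter fun q : Fin n => s.arr absentA q = 0 :=
      Finset.mem_filter.2 ⟨Finset.mem_univ _, hnew q hq⟩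
    rw [← heq] at hmem
    have := (Finset.mem_filter.1 hmem).2
    rw [habs, if_neg hq] at this
    omega

/-- The time that pays for popping a set and recognizing it. -/
def popTime (n : ℕ) : ℕ := 56 * n + 80

/-- The time that pays for processing a new set and for popping the sets that it puts on the
queue. -/
def processTime (n k : ℕ) : ℕ := 21 * n + 40 + k * (63 * n + 80 + 9) + k * popTime n

/-- The body of the main loop. -/
def mainBody : Cmd := block [
  popNext,
  ite (lt (var sizeSV) (var sizeTV))
    (set ansV (lit 0))
    (ite (var oldV)
      (block [compareWithOld, ite (var flagV) skip (set ansV (lit 0))])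
      (block [markAbsent, pushPredecessors]))]

/-- The invariant of the main loop, with the time that the rest of the loop may take: the queued
sets still have to be popped, and each new set consumes an unmarked state. Once the answer is `0`,
the loop is about to end, and `φ` is unrestricted. -/
def MainInv (δ : Fin n → Fin k → Fin n) (S : Finset (Fin n)) (s : State) (φ : ℕ) : Prop :=
  s.var ansV = 0 ∧ ¬ WitnessCandidate δ S ∨
    s.var ansV = 1 ∧ ∃ X h m, Represents δ S X h m s ∧
      φ = (m - h) * popTime n + unmarked n s * processTime n k

/-- One round of the main loop is paid for by the potential of `MainInv`; the `6` extra steps are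
those of testing the loop condition. -/
theorem run_mainBody {X : ℕ → Finset (Fin n)} {h m : ℕ} {s : State} (hS : S ≠ Finset.univ)
    (hs : Represents δ S X h m s) (hans : s.var ansV = 1) (hh : h < m) :
    Run mainBody s fun t s' => ∃ φ, MainInv δ S s' φ ∧
      t + 6 + φ ≤ (m - h) * popTime n + unmarked n s * processTime n k := by
  have hpay : (m - h) * popTime n = (m - (h + 1)) * popTime n + popTime n := by
    rw [← Nat.succ_mul]
    congr 1
    omega
  have hpop : popTime n = 56 * n + 80 := rfl
  have hpr : processTime n k = 21 * n + 40 + k * (63 * n + 80 + 9) + k * popTime n := rfl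
  rw [hpay]
  simp only [mainBody, block_cons, block_nil, run_seq]
  refine (run_popNext hs hh).and_agree.mono ?_
  rintro t₁ s₁ ⟨⟨ht₁, hcur, hhead, hsize, hold⟩, hag₁⟩
  have a₁ : s₁.var ansV = 1 := (hag₁.var ansV rfl).trans hans
  have hsS : s₁.var sizeSV = S.card := (hag₁.var sizeSV rfl).trans hs.size
  have htl : s₁.var tailV = m * n := (hag₁.var tailV rfl).trans hs.tail
  have hn : s₁.var nV = n := (hag₁.var nV rfl).trans hs.n_eq
  have hk : s₁.var kV = k := (hag₁.var kV rfl).trans hs.k_eq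
  have hq₁ : s₁.arr queueA = s.arr queueA := hag₁.arr queueA rfl
  have hb₁ : s₁.arr absentA = s.arr absentA := hag₁.arr absentA rfl
  have hd₁ : s₁.arr deltaA = s.arr deltaA := hag₁.arr deltaA rfl
  have hst : ∀ j < m, Stores s₁ (j * n) (X j) := by
    intro j hj q
    rw [hq₁]
    exact hs.stores j hj q
  have hpred := hs.search.pred
  rw [run_ite]
  constructor
  · -- The set is too large.
    intro hlt
    have hlt' : S.card < (X h).card := by
      by_contra hcon
      simp only [Expr.eval, hsS, hsize, if_neg hcon] at hlt
      exact hlt rfl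
    simp only [run_set, run_skip]
    refine ⟨0, .inl ⟨by simp, fun hw => hw.2.2.1 _ (hpred h hh) hlt'⟩, ?_⟩
    simp only [Expr.cost]
    omega
  intro hle
  have hle' : (X h).card ≤ S.card := by
    by_contra hcon
    simp only [Expr.eval, hsS, hsize, if_pos (not_le.1 hcon)] at hle
    exact one_ne_zero hle
  rw [run_ite]
  simp only [Expr.eval, Expr.cost]
  constructor
  · -- A processed set `X j` lacks a state `q` that is not in `X h` either.
    intro hne
    obtain ⟨q, hq, hqa, -⟩ := hold.resolve_left fun h0 => hne h0.1
    obtain ⟨j, hj, hja, hqj⟩ := (hs.absent q).resolve_left fun h0 => hne (hqa ▸ h0.1)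
    rw [run_seq]
    refine (run_compareWithOld hn hcur (hqa.symm.trans hja) (hst h hh)
      (hst j (by omega))).and_agree.mono ?_
    rintro t₂ s₂ ⟨⟨ht₂, hflag⟩, hag₂⟩
    rw [run_seq, run_ite]
    simp only [run_skip, run_set, Expr.eval, Expr.cost]
    constructor
    · intro hf
      have hX := hflag.1 hf
      have hb₂ : s₂.arr absentA = s.arr absentA := (hag₂.arr absentA rfl).trans hb₁
      refine ⟨_, .inr ⟨(hag₂.var ansV rfl).trans a₁, X, h + 1, m,
        hs.skip hh hj hX ?_ ?_ ?_, rfl⟩, ?_⟩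
      · intro v hv
        fin_cases hv
        · exact (hag₂.var nV rfl).trans (hag₁.var nV rfl)
        · exact (hag₂.var kV rfl).trans (hag₁.var kV rfl)
        · exact (hag₂.var sizeSV rfl).trans (hag₁.var sizeSV rfl)
        · exact (hag₂.var tailV rfl).trans (hag₁.var tailV rfl)
      · intro a ha
        fin_cases ha
        · exact (hag₂.arr deltaA rfl).trans hd₁
        · exact (hag₂.arr queueA rfl).trans hq₁
        · exact hb₂
      · exact (hag₂.var headV rfl).trans hhead
      · have : unmarked n s₂ = unmarked n s := by rw [unmarked, hb₂, unmarked]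
        rw [this]
        omega
    · intro hf
      have hX : X h ≠ X j := fun he => hflag.2 he hf
      refine ⟨0, .inl ⟨by simp, fun hw => ?_⟩, by omega⟩
      exact Finset.disjoint_left.1 (hw.2.2.2 _ _ (hpred h hh) (hpred j (by omega)) hX)
        (Finset.mem_compl.2 hq) (Finset.mem_compl.2 hqj)
  · -- The set is new, and its complement is disjoint from those of the processed sets.
    intro h0
    have hnew : ∀ q ∉ X h, s.arr absentA q = 0 := by
      rcases hold with hold | ⟨q, -, -, hne⟩
      · exact hold.2
      · exact absurd h0 hne
    rw [run_seq]
    refine (run_markAbsent hn hcur (hst h hh)).and_agree.mono ?_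
    rintro t₂ s₂ ⟨⟨ht₂, habs⟩, hag₂⟩
    have hd₂ : s₂.arr deltaA = s.arr deltaA := (hag₂.arr deltaA rfl).trans hd₁
    rw [run_seq]
    refine (run_pushPredecessors (δ := δ) (X := X) (h := h) (m := m)
      ((hag₂.var nV rfl).trans hn) ((hag₂.var kV rfl).trans hk) ?_ ((hag₂.var curV rfl).trans hcur)
      ((hag₂.var tailV rfl).trans htl) hh ?_).and_agree.mono ?_
    · rw [hd₂]
      exact hs.delta
    · intro j hj q
      rw [hag₂.arr queueA rfl]
      exact hst j hj q
    rintro t₃ s₃ ⟨⟨ht₃, X', m', hm, hmk, htl', hX', hst', hpred', hcl⟩, hag₃⟩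
    have habs' : ∀ q : Fin n,
        s₃.arr absentA q = if q ∈ X h then s.arr absentA q else h * n + 1 := by
      intro q
      rw [hag₃.arr absentA rfl, habs, hb₁]
    simp only [run_skip]
    refine ⟨_, .inr ⟨(hag₃.var ansV rfl).trans ((hag₂.var ansV rfl).trans a₁), X', h + 1, m',
      hs.process hh hle' hnew ?_ ((hag₃.arr deltaA rfl).trans hd₂)
        ((hag₃.var headV rfl).trans ((hag₂.var headV rfl).trans hhead)) htl' hm hX' hst' habs'
        hpred' hcl, rfl⟩, ?_⟩
    · intro v hv
      fin_cases hv
      · exact (hag₃.var nV rfl).trans ((hag₂.var nV rfl).trans (hag₁.var nV rfl))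
      · exact (hag₃.var kV rfl).trans ((hag₂.var kV rfl).trans (hag₁.var kV rfl))
      · exact (hag₃.var sizeSV rfl).trans ((hag₂.var sizeSV rfl).trans (hag₁.var sizeSV rfl))
    · have huniv : X h ≠ Finset.univ := by
        intro heq
        refine hS ((Finset.card_eq_iff_eq_univ S).1 (le_antisymm (Finset.card_le_univ S) ?_))
        rwa [heq] at hle'
      have hu := unmarked_lt huniv hnew habs'
      have h1 : (unmarked n s₃ + 1) * processTime n k ≤ unmarked n s * processTime n k :=
        Nat.mul_le_mul_right _ hu
      have h2 : (m' - (h + 1)) * popTime n ≤ (m - (h + 1)) * popTime n + k * popTime n := by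
        rw [← Nat.add_mul]
        exact Nat.mul_le_mul_right _ (by omega)
      rw [Nat.succ_mul] at h1
      omega

theorem run_program {s : State} (hne : S.Nonempty) (hS : S ≠ Finset.univ)
    (hs : HasInput δ S s) :
    Run program s fun t s' => t ≤ 24 * n + 40 + popTime n + n * processTime n k ∧
      (WitnessCandidate δ S → s'.var ansV = 1) ∧ (¬ WitnessCandidate δ S → s'.var ansV = 0) := by
  have hn : 0 < n := by
    obtain ⟨q, -⟩ := hne
    exact q.pos
  change Run (block [pushInput, loop _ mainBody]) s _
  simp only [block_cons, block_nil, run_seq]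
  refine (run_pushInput hs).mono ?_
  rintro t₁ s₁ ⟨ht₁, hans, hrep⟩
  refine run_loop (MainInv δ S) ?_ _ s₁ (.inr ⟨hans, _, _, _, hrep, rfl⟩) ?_
  · rintro s φ (⟨hans, -⟩ | ⟨hans, X, h, m, hrep, rfl⟩) hb
    · exact absurd (by simp only [Expr.eval, hans]; simp) hb
    · have hh : h < m := by
        by_contra hcon
        refine hb ?_
        have : ¬ h * n < m * n := not_lt.2 (Nat.mul_le_mul_right n (not_lt.1 hcon))
        simp only [Expr.eval, hrep.head, hrep.tail, if_neg this]
        simp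
      exact run_mainBody hS hrep hans hh
  · rintro t s' φ hinv hb ht
    simp only [run_skip]
    have hu : unmarked n s₁ ≤ n := (Finset.card_le_univ _).trans_eq (Fintype.card_fin n)
    have hu' := Nat.mul_le_mul_right (processTime n k) hu
    simp only [Expr.cost] at ht
    refine ⟨by omega, ?_⟩
    rcases hinv with ⟨h0, hw⟩ | ⟨h1, X, h, m, hrep, -⟩
    · exact ⟨fun h => absurd h hw, fun _ => h0⟩
    · have hm : ¬ h < m := by
        intro hlt
        have : h * n < m * n := Nat.mul_lt_mul_of_pos_right hlt hn
        simp only [Expr.eval, hrep.head, hrep.tail, h1, if_pos this] at hb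
        simp at hb
      obtain rfl : h = m := le_antisymm hrep.search.head_le (not_lt.1 hm)
      exact ⟨fun _ => h1, fun h => absurd (hrep.search.witnessCandidate hne hS) h⟩

/-- The time bound of `run_program` is `O(n² max(1, k))`; the constant is generous. -/
theorem time_le (hn : 0 < n) :
    24 * n + 40 + popTime n + n * processTime n k ≤ 700 * (n ^ 2 * max 1 k) := by
  have h1 : 1 ≤ max 1 k := le_max_left _ _
  have h2 : k ≤ max 1 k := le_max_right _ _
  generalize max 1 k = K at h1 h2
  have h3 : n ≤ n * n := Nat.le_mul_self n
  have h4 : n * n ≤ n * n * K := Nat.le_mul_of_pos_right _ h1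
  have h5 : n * n * k ≤ n * n * K := Nat.mul_le_mul_left _ h2
  have h6 : n * k ≤ n * n * k := Nat.mul_le_mul_right _ h3
  have e : n * processTime n k = 21 * (n * n) + 40 * n + 119 * (n * n * k) + 169 * (n * k) := by
    simp only [processTime, popTime]
    ring
  rw [e, popTime, sq]
  omega

/-! ### The verifier -/

/-- The number of decoded numbers. -/
abbrev wordsV : ℕ := 13
/-- The length of the current block of ones. -/
abbrev onesV : ℕ := 14
abbrev iV : ℕ := 15
/-- The product `k * n`. -/
abbrev prodV : ℕ := 16
/-- Non-zero if the input encodes an automaton. -/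
abbrev validV : ℕ := 17
/-- Non-zero if some state belongs to the certificate. -/
abbrev someV : ℕ := 18
/-- Non-zero if some state does not belong to the certificate. -/
abbrev restV : ℕ := 19
/-- The decoded numbers. -/
abbrev wordsA : ℕ := 5

attribute [local simp] wordsV onesV iV prodV validV someV restV wordsA

/-- Decode the bit string in array `0`, whose length is in register `0`. -/
def decodeInput : Cmd := block [
  set wordsV (lit 0), set onesV (lit 0),
  forLoop iV (var 0) [
    ite (get 0 (var iV))
      (set onesV (add (var onesV) (lit 1)))
      (block [put wordsA (var wordsV) (var onesV), set wordsV (add (var wordsV) (lit 1)),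
        set onesV (lit 0)])]]

/-- Check that the decoded numbers are `n`, `k` and `k * n` numbers below `n`, and copy them to
where `program` expects them. The product `k * n` is computed by repeated addition. -/
def checkTable : Cmd := block [
  set nV (get wordsA (lit 0)), set kV (get wordsA (lit 1)), set prodV (lit 0),
  forLoop iV (var kV) [set prodV (add (var prodV) (var nV))],
  set validV (and (eq (var wordsV) (add (var prodV) (lit 2))) (eq (var onesV) (lit 0))),
  forLoop iV (var prodV) [
    put deltaA (var iV) (get wordsA (add (var iV) (lit 2))),
    ite (lt (get wordsA (add (var iV) (lit 2))) (var nV)) skip (set validV (lit 0))]]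

/-- Look for a state inside and for a state outside the certificate. -/
def checkProper : Cmd := block [
  set someV (lit 0), set restV (lit 0),
  forLoop iV (var nV) [
    ite (get inputA (var iV)) (set someV (lit 1)) (set restV (lit 1))]]

/-- The verifier for the complement of Completely Reachable: accept bit strings that encode no
automaton, and otherwise run `program` on the set of states given by the certificate. -/
def verifier : Cmd := block [
  decodeInput, checkTable, checkProper,
  ite (var validV)
    (ite (and (var someV) (var restV)) program (set ansV (lit 0)))
    (set ansV (lit 1))]

theorem run_decodeInput (x y : List Bool) :
    Run decodeInput (initState x y) fun t s => t ≤ 23 * x.length + 20 ∧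
      s.var wordsV = (decode x).1.length ∧ s.var onesV = (decode x).2 ∧
      ∀ j, s.arr wordsA j = (decode x).1.getD j 0 := by
  simp only [decodeInput, block_cons, block_nil, run_seq, run_set]
  refine run_forLoop (fun i s => s.var wordsV = (decode (x.take i)).1.length ∧
      s.var onesV = (decode (x.take i)).2 ∧
      ∀ j, s.arr wordsA j = (decode (x.take i)).1.getD j 0) 14 x.length (by simp [initState])
    rfl rfl (by simp [decode, initState]) ?_ ?_
  · rintro i s hi hq hag ⟨h1, h2, h3⟩
    have e0 := hag.arr 0 rfl
    rw [List.take_succ_eq_append_getElem hi, decode_concat]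
    generalize decode (x.take i) = d at h1 h2 h3
    have hx : s.arr 0 i = (x[i]).toNat := by
      simp [e0, initState, hi]
    simp at h1 h2 h3 hq
    cases hxi : x[i]
    · simp [hq, hx, hxi, h1, h2, h3, decodeStep]
      intro j
      by_cases hj : j < d.1.length
      · rw [if_neg hj.ne, List.getElem?_append_left hj]
      · rw [List.getElem?_append_right (not_lt.1 hj)]
        by_cases hj' : j = d.1.length
        · simp [hj']
        · rw [if_neg hj', List.getElem?_eq_none (not_lt.1 hj),
            List.getElem?_eq_none (by simp; omega)]
    · simp [hq, hx, hxi, h1, h2, h3, decodeStep]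
  · rintro t s ht hag ⟨h1, h2, h3⟩
    rw [List.take_length] at h1 h2 h3
    simp only [run_skip, Expr.cost]
    exact ⟨by omega, h1, h2, h3⟩

theorem run_checkTable {s : State} {ws : List ℕ} {c n k : ℕ} (hlen : s.var wordsV = ws.length)
    (hc : s.var onesV = c) (hws : ∀ j, s.arr wordsA j = ws.getD j 0)
    (hn : ws.getD 0 0 = n) (hk : ws.getD 1 0 = k) :
    Run checkTable s fun t s' => t ≤ 14 * k + 30 * (k * n) + 50 ∧ s'.var nV = n ∧ s'.var kV = k ∧
      (∀ i < k * n, s'.arr deltaA i = ws.getD (i + 2) 0) ∧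
      (s'.var validV ≠ 0 ↔ c = 0 ∧ IsTable ws) := by
  simp only [checkTable, block_cons, block_nil, run_seq, run_set]
  have hn' := (hws 0).trans hn
  have hk' := (hws 1).trans hk
  simp at hn' hk'
  refine run_forLoop (fun i s' => s'.var prodV = i * n) 5 k (by simp [hk']) rfl rfl (by simp) ?_ ?_
  · rintro i s' hi hq hag h1
    have e1 := hag.var 1 rfl
    simp at e1 h1
    simp [e1, h1, hn']
    ring
  rintro t₁ s₁ ht₁ hag₁ h₁
  have n₁ := hag₁.var 1 rfl
  have k₁ := hag₁.var 2 rfl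
  have w₁ := hag₁.var 13 rfl
  have o₁ := hag₁.var 14 rfl
  have a₁ := hag₁.arr 5 rfl
  simp at n₁ k₁ w₁ o₁ a₁ hlen hc h₁ hws
  rw [hn'] at n₁
  rw [hk'] at k₁
  refine run_forLoop (fun i s' => (∀ j < i, s'.arr deltaA j = ws.getD (j + 2) 0) ∧
    (s'.var validV ≠ 0 ↔ (ws.length = k * n + 2 ∧ c = 0) ∧ ∀ j < i, ws.getD (j + 2) 0 < n))
    20 (k * n) (by simpa using h₁) rfl rfl ?_ ?_ ?_
  · simp [w₁, o₁, h₁, hlen, hc]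
  · rintro i s' hi hq hag ⟨h1, h2⟩
    have e1 := hag.var 1 rfl
    have a5 := hag.arr 5 rfl
    simp at e1 a5 hq h1 h2
    rw [n₁] at e1
    rw [a₁] at a5
    have split : (∀ j ≤ i, ws[j + 2]?.getD 0 < n) ↔
        (∀ j < i, ws[j + 2]?.getD 0 < n) ∧ ws[i + 2]?.getD 0 < n := by
      constructor
      · exact fun h => ⟨fun j hj => h j hj.le, h i le_rfl⟩
      · rintro ⟨h, h'⟩ j hj
        rcases Nat.lt_or_eq_of_le hj with hj | rfl
        · exact h j hj
        · exact h'
    have hcopy : ∀ j ≤ i, (if j = i then ws[i + 2]?.getD 0 else s'.arr 0 j) =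
        ws[j + 2]?.getD 0 := by
      intro j hj
      split_ifs with hji
      · rw [hji]
      · exact h1 j (by omega)
    simp only [block_cons, block_nil, run_seq, run_put, run_ite, run_skip, run_set]
    simp [hq, e1, a5, hws, h2]
    rw [split]
    constructor
    · intro hlt
      exact ⟨hcopy, by simp [hlt]⟩
    · intro hle
      exact ⟨hcopy, fun _ _ => ⟨i, le_rfl, hle⟩⟩
  · rintro t₂ s₂ ht₂ hag₂ ⟨h1, h2⟩
    have n₂ := hag₂.var 1 rfl
    have k₂ := hag₂.var 2 rfl
    simp at n₂ k₂
    simp only [run_skip, Expr.cost]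
    refine ⟨by omega, n₂.trans n₁, k₂.trans k₁, h1, h2.trans ?_⟩
    rw [IsTable, hn, hk]
    tauto

/-- The certificate only qualifies as a witness candidate if it is non-empty and proper, which
`run_program` presupposes. -/
theorem run_checkProper {n : ℕ} {S : Finset (Fin n)} {s : State} (hn : s.var nV = n)
    (hS : ∀ q : Fin n, s.arr inputA q = if q ∈ S then 1 else 0) :
    Run checkProper s fun t s' => t ≤ 20 * n + 20 ∧
      (s'.var someV ≠ 0 ↔ S.Nonempty) ∧ (s'.var restV ≠ 0 ↔ S ≠ Finset.univ) := by
  simp only [checkProper, block_cons, block_nil, run_seq, run_set]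
  refine run_forLoop (fun i s' =>
    (s'.var someV ≠ 0 ↔ ∃ q : Fin n, (q : ℕ) < i ∧ q ∈ S) ∧
    (s'.var restV ≠ 0 ↔ ∃ q : Fin n, (q : ℕ) < i ∧ q ∉ S)) 9 n (by simpa using hn) rfl rfl
    (by simp) ?_ ?_
  · rintro i s' hi hq hag ⟨h1, h2⟩
    have a1 := hag.arr 1 rfl
    have hSi := hS ⟨i, hi⟩
    simp at a1 hSi hq
    have split : ∀ p : Fin n → Prop, (∃ q : Fin n, (q : ℕ) < i + 1 ∧ p q) ↔
        (∃ q : Fin n, (q : ℕ) < i ∧ p q) ∨ p ⟨i, hi⟩ := by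
      intro p
      constructor
      · rintro ⟨q, hqi, hp⟩
        rcases Nat.lt_succ_iff_lt_or_eq.1 hqi with h | h
        · exact .inl ⟨q, h, hp⟩
        · exact .inr (by rwa [show q = ⟨i, hi⟩ from Fin.ext h] at hp)
      · rintro (⟨q, hqi, hp⟩ | hp)
        · exact ⟨q, by omega, hp⟩
        · exact ⟨_, by simp, hp⟩
    rw [split (· ∈ S), split (· ∉ S)]
    rw [← h1, ← h2]
    by_cases hX : (⟨i, hi⟩ : Fin n) ∈ S <;> simp [hq, a1, hSi, hX]
  · rintro t s' ht hag ⟨h1, h2⟩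
    simp only [run_skip, Expr.cost]
    refine ⟨by omega, h1.trans ?_, h2.trans ?_⟩
    · exact ⟨fun ⟨q, _, h⟩ => ⟨q, h⟩, fun ⟨q, h⟩ => ⟨q, q.2, h⟩⟩
    · rw [Ne, Finset.eq_univ_iff_forall, not_forall]
      exact ⟨fun ⟨q, _, h⟩ => ⟨q, h⟩, fun ⟨q, h⟩ => ⟨q, q.2, h⟩⟩

/-- The set of states whose characteristic vector is given by the certificate `y`. Missing bits
count as `0`, and bits from position `n` on are ignored. -/
def certificateSet (n : ℕ) (y : List Bool) : Finset (Fin n) :=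
  Finset.univ.filter fun q => y.getD q false = true

/-- The certificate `y` shows that `x` does not encode a completely reachable automaton. If `x`
encodes no automaton at all, every certificate does. -/
def Accepts (x y : List Bool) : Prop :=
  ∀ (n k : ℕ) (δ : Fin n → Fin k → Fin n), x = encode δ →
    WitnessCandidate δ (certificateSet n y)

/-- Bit strings encode at most one automaton, so `Accepts` speaks of a single one. -/
theorem accepts_encode {n k : ℕ} {δ : Fin n → Fin k → Fin n} {y : List Bool} :
    Accepts (encode δ) y ↔ WitnessCandidate δ (certificateSet n y) := by
  refine ⟨fun h => h n k δ rfl, fun h n' k' δ' he => ?_⟩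
  cases encode_injective he
  exact h

theorem le_length_encode {n k : ℕ} (δ : Fin n → Fin k → Fin n) : n ≤ (encode δ).length := by
  simp [encode, toWords]

theorem notMem_completelyReachableProblem_iff {x : List Bool} {B : ℕ} (hB : x.length ≤ B) :
    x ∉ completelyReachableProblem ↔ ∃ y : List Bool, y.length ≤ B ∧ Accepts x y := by
  constructor
  · intro hx
    by_cases h : ∃ (n k : ℕ) (δ : Fin n → Fin k → Fin n), x = encode δ
    · obtain ⟨n, k, δ, rfl⟩ := h
      obtain ⟨S, hS⟩ := exists_witnessCandidate fun hr => hx ⟨n, k, δ, rfl, hr⟩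
      refine ⟨List.ofFn fun q => decide (q ∈ S), by simpa using (le_length_encode δ).trans hB, ?_⟩
      rw [accepts_encode]
      convert hS
      ext q
      simp [certificateSet]
    · exact ⟨[], Nat.zero_le _, fun n k δ he => absurd ⟨n, k, δ, he⟩ h⟩
  · rintro ⟨y, -, hy⟩ ⟨n, k, δ, rfl, hr⟩
    exact (accepts_encode.1 hy).not_completelyReachable hr

theorem run_verifier (x y : List Bool) :
    Run verifier (initState x y) fun t s =>
      t ≤ 1000 * (x.length + 1) ^ 3 ∧ (s.var ansV = 1 ↔ Accepts x y) := by
  simp only [verifier, block_cons, block_nil, run_seq]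
  refine (run_decodeInput x y).and_agree.mono ?_
  rintro t₁ s₁ ⟨⟨ht₁, hlen, hones, hws⟩, hag₁⟩
  -- The candidates for the numbers of states and letters; they are small even if `x` is malformed.
  obtain ⟨n, hn⟩ : ∃ n, (decode x).1.getD 0 0 = n := ⟨_, rfl⟩
  obtain ⟨k, hk⟩ : ∃ k, (decode x).1.getD 1 0 = k := ⟨_, rfl⟩
  have hnL : n ≤ x.length := hn ▸ getD_decode_le x 0
  have hkL : k ≤ x.length := hk ▸ getD_decode_le x 1
  refine (run_checkTable hlen hones hws hn hk).and_agree.mono ?_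
  rintro t₂ s₂ ⟨⟨ht₂, hn₂, hk₂, hδ₂, hvalid⟩, hag₂⟩
  have hS₂ : ∀ q : Fin n, s₂.arr inputA q = if q ∈ certificateSet n y then 1 else 0 := by
    intro q
    rw [hag₂.arr inputA rfl, hag₁.arr inputA rfl]
    simp only [initState, certificateSet, Finset.mem_filter, Finset.mem_univ, true_and]
    cases y.getD q false <;> rfl
  refine (run_checkProper hn₂ hS₂).and_agree.mono ?_
  rintro t₃ s₃ ⟨⟨ht₃, hsome, hrest⟩, hag₃⟩
  have hvalid₃ : s₃.var validV ≠ 0 ↔ (decode x).2 = 0 ∧ IsTable (decode x).1 := by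
    rw [hag₃.var validV rfl]
    exact hvalid
  -- Everything outside the run of `program` is dominated by the quadratic check of the table.
  have hL : x.length + 1 ≤ (x.length + 1) ^ 2 := Nat.le_self_pow two_ne_zero _
  have hL' : (x.length + 1) ^ 2 ≤ (x.length + 1) ^ 3 := Nat.pow_le_pow_right (by omega) (by omega)
  have hkn : k * n ≤ (x.length + 1) ^ 2 := by
    rw [sq]
    exact Nat.mul_le_mul (by omega) (by omega)
  have htime : t₁ + t₂ + t₃ + 20 ≤ 250 * (x.length + 1) ^ 3 := by omega
  rw [run_ite]
  constructor
  · intro hv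
    obtain ⟨h0, htab⟩ := hvalid₃.1 hv
    obtain ⟨δ, hδ⟩ := htab.exists_eq hn hk
    have hacc : Accepts x y ↔ WitnessCandidate δ (certificateSet n y) := by
      rw [encode_eq_iff.2 ⟨h0, hδ.symm⟩]
      exact accepts_encode
    rw [hacc, run_ite]
    simp only [Expr.eval, Expr.cost, hsome, hrest]
    constructor
    · intro hproper
      obtain ⟨hne, huniv⟩ : (certificateSet n y).Nonempty ∧ certificateSet n y ≠ Finset.univ := by
        by_contra hcon
        exact hproper (if_neg hcon)
      have hin : HasInput δ (certificateSet n y) s₃ := by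
        refine ⟨(hag₃.var nV rfl).trans hn₂, (hag₃.var kV rfl).trans hk₂, fun q a => ?_,
          fun q => ?_⟩
        · rw [hag₃.arr deltaA rfl, hδ₂ _ (mul_add_lt q a), ← hδ, getD_toWords]
        · rw [hag₃.arr inputA rfl, hS₂]
      refine (run_program hne huniv hin).mono ?_
      rintro t s ⟨ht, h1, h0⟩
      simp only [run_skip]
      have hprog : n ^ 2 * max 1 k ≤ (x.length + 1) ^ 3 := by
        rw [pow_succ (x.length + 1) 2]
        exact Nat.mul_le_mul (Nat.pow_le_pow_left (by omega) 2) (by omega)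
      have ht' := time_le (n := n) (k := k) hne.choose.pos
      refine ⟨by omega, fun h => ?_, h1⟩
      by_contra hw
      rw [h0 hw] at h
      exact zero_ne_one h
    · intro hproper
      simp only [run_set, run_skip, Expr.cost]
      refine ⟨by omega, ?_⟩
      simp
      intro hw
      rw [if_pos ⟨hw.1, hw.2.1⟩] at hproper
      exact one_ne_zero hproper
  · intro hv
    simp only [run_set, run_skip, Expr.cost]
    refine ⟨by omega, ?_⟩
    simp only [setVar_var, if_true, Expr.eval, true_iff]
    rintro n k δ rfl
    obtain ⟨h0, hw⟩ := encode_eq_iff.1 (rfl : encode δ = encode δ)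
    exact absurd hv (hvalid₃.2 ⟨h0, hw ▸ isTable_toWords δ⟩)

theorem inCoNP_completelyReachableProblem : InCoNP completelyReachableProblem := by
  refine ⟨verifier, 1000 * (Polynomial.X + 1) ^ 3, fun x => ?_⟩
  have heval : (1000 * (Polynomial.X + 1) ^ 3 : Polynomial ℕ).eval x.length =
      1000 * (x.length + 1) ^ 3 := by
    simp
  rw [heval]
  have hle : x.length ≤ 1000 * (x.length + 1) ^ 3 := by
    have : x.length + 1 ≤ (x.length + 1) ^ 3 := Nat.le_self_pow three_ne_zero _
    omega
  refine ⟨fun y _ => ?_, ?_⟩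
  · obtain ⟨t, s, he, ht, -⟩ := run_verifier x y
    exact ⟨t, s, he, ht⟩
  · rw [Set.mem_compl_iff, notMem_completelyReachableProblem_iff hle]
    constructor
    · rintro ⟨y, hy, hacc⟩
      obtain ⟨t, s, he, -, hs⟩ := run_verifier x y
      exact ⟨y, hy, t, s, he, hs.2 hacc⟩
    · rintro ⟨y, hy, t, s, he, hs⟩
      obtain ⟨t', s', he', -, hs'⟩ := run_verifier x y
      obtain ⟨-, rfl⟩ := he.deterministic he'
      exact ⟨y, hy, hs'.1 hs⟩

end IsWitnessCandidate

theorem mainTheorem4 :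
    -- the problem Completely Reachable is in co-NP
    RAM.InCoNP Automaton.completelyReachableProblem ∧
    -- non-complete-reachability is certified by witness candidates
    (∀ (Q A : Type*) [Fintype Q] [DecidableEq Q] (δ : Q → A → Q),
      ¬ Automaton.CompletelyReachable δ ↔ ∃ S, Automaton.WitnessCandidate δ S) ∧
    -- IsWitnessCandidate is correct and halts within `O(n² |Σ|)` steps
    (∃ C : ℕ, ∀ (n k : ℕ) (δ : Fin n → Fin k → Fin n) (S : Finset (Fin n)),
      S.Nonempty → S ≠ Finset.univ →
      ∀ s : RAM.State, IsWitnessCandidate.HasInput δ S s →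
        ∃ (t : ℕ) (s' : RAM.State), RAM.Exec IsWitnessCandidate.program s t s' ∧
          t ≤ C * (n ^ 2 * max 1 k) ∧
          (Automaton.WitnessCandidate δ S → s'.var IsWitnessCandidate.ansV = 1) ∧
          (¬ Automaton.WitnessCandidate δ S → s'.var IsWitnessCandidate.ansV = 0)) := by
  refine ⟨IsWitnessCandidate.inCoNP_completelyReachableProblem,
    fun Q A _ _ δ => Automaton.not_completelyReachable_iff, 700, fun n k δ S hne hS s hs => ?_⟩
  obtain ⟨t, s', he, ht, hw⟩ := IsWitnessCandidate.run_program hne hS hs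
  exact ⟨t, s', he, ht.trans (IsWitnessCandidate.time_le hne.choose.pos), hw⟩
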